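/- Let $H$ be an infinite-dimensional real Hilbert space, $\tilde H=H+iH$ its complexification with norm $|\cdot|$ and inner product $(\cdot,\cdot)$, and let $A:D(A)\subset H\to H$ be a densely defined, self-adjoint, positive definite operator with compact resolvent. Let $\{\phi_n\}_{n\ge1}$ be an orthonormal basis of $H$ of eigenvectors of $A$, $A\phi_n=\lambda_n\phi_n$, $\lambda_1\le\lambda_2\le\cdots$. Let $B\in\mathcal L(H)$, $\delta>0$ and $\beta(t)=e^{-\delta t}$ (that is, $\beta'+\delta\beta=0$, $\beta(0)=1$). $A$ and $B$ are extended complex-linearly to $\tilde H$. Consider $$\mathbf y'(t)+A\mathbf y(t)+\int_0^t\beta(t-s)A\mathbf y(s)\,ds=Bu(t)\quad(t\ge0),\qquad \mathbf y(0)=\mathbf y_0\in\tilde H .\tag{1}$$ A (weak) solution of (1) is a $\mathbf y\in C([0,\infty);\tilde H)$ with $\mathbf y(0)=\mathbf y_0$ and $\frac{d}{dt}(\mathbf y(t),\psi)+(\mathbf y(t),A\psi)+\int_0^t\beta(t-s)(\mathbf y(s),A\psi)\,ds=(Bu(t),\psi)$ for all $\psi\in D(A)$, $t\ge 0$; it is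 classical if $\mathbf y\in C^1([0,\infty);\tilde H)\cap C([0,\infty);D(A))$ and (1) holds in $\tilde H$. Put $$\mu_n^\pm=\tfrac12\Big(\lambda_n+\delta\pm\sqrt{(\lambda_n-\delta)^2-4\lambda_n}\Big)\in\mathbb C,\qquad \omega_0=\delta+1,$$ let $0<\gamma<\omega_0$, and let $N=\max\{N_1,N_2\}$ with $N_1=\sup\{j:\operatorname{Re}\mu_j^+\le\gamma\}$, $N_2=\sup\{j:\operatorname{Re}\mu_j^-\le\gamma\}$ ($\sup\emptyset=0$); $N$ is finite. Let the $l$ distinct values among $\lambda_1,\dots,\lambda_N$ have multiplicities $m_1,\dots,m_l$ (in increasing order of the values), and let $M=\max_k m_k$ ($M=0$ if $N=0$). For $\Phi_1,\dots,\Phi_M\in\tilde H$ set $$P_{2N}=\begin{pmatrix}0&I_N\\-\operatorname{diag}(\lambda_j(1+\delta))&-\operatorname{diag}(\lambda_j+\delta)\end{pmatrix},\qquad Q_{2NM}=\begin{pmatrix}0_{N\times M}\\ C_{NM}\end{pmatrix},\qquad (C_{NM})_{ji}=(B\Phi_i,\phi_j).$$ The eigenvalues of $P_{2N}$ are $-\mu_j^\pm$,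 $1\le j\le N$. For a $2N\times M$ matrix $\overline Q$ and $1\le k\le l$ let $\overline Q_k$ (resp. $\overline Q_{k+l}$) be the $M\times m_k$ submatrix of the conjugate transpose $\overline Q^*$ formed by the columns $j$ (resp. $N+j$) with $m_1+\dots+m_{k-1}<j\le m_1+\dots+m_k$. Assume one of the following. (a) All eigenvalues of $P_{2N}$ are semisimple, $\Phi_i=\phi_i$ for $1\le i\le M$, and for some invertible complex matrix $R$ with $P_{2N}=R^{-1}DR$, $D=\operatorname{diag}(-\mu_1^+,\dots,-\mu_N^+,-\mu_1^-,\dots,-\mu_N^-)$, the matrix $\overline Q=RQ_{2NM}$ satisfies $\operatorname{rank}\overline Q_k=\operatorname{rank}\overline Q_{k+l}=m_k$ for all $k=1,\dots,l$. (b) Not all eigenvalues of $P_{2N}$ are semisimple, $\Phi_1,\dots,\Phi_M\in\operatorname{span}_{\mathbb C}\{\phi_1,\dots,\phi_N\}$, and for some invertible complex matrix $\overline R$ with $P_{2N}=\overline R^{-1}J\overline R$, where $J$ is a matrix with diagonal $-\mu_1^+,\dots,-\mu_N^+,-\mu_1^-,\dots,-\mu_N^-$ (in this order) that is a Jordan matrix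 up to a permutation of the coordinates, the matrix $\overline Q=\overline RQ_{2NM}$ satisfies $\operatorname{rank}\overline Q_k=\operatorname{rank}\overline Q_{k+l}=m_k$ for all $k=1,\dots,l$. Then $\Phi_1,\dots,\Phi_M\in D(A)$, and controllers of the form $u(t)=\sum_{i=1}^M\Phi_iv_i(t)$ stabilize (1) exponentially with rate $\gamma$, in each of the following two ways. 1. For every $T>0$ there is a constant $C$ such that for every $\mathbf y_0\in\tilde H$ there are $v_1,\dots,v_M\in C([0,\infty);\mathbb C)$ and $w_1,\dots,w_M\in L^2(0,T;\mathbb C)$ with $$v_i(t)=-\int_t^T\beta(t-s)w_i(s)\,ds\ (0\le t\le T),\quad \int_0^T|w_i(t)|^2dt\le C|\mathbf y_0|^2,\quad v_i(t)=0=w_i(t)\ (t\ge T),$$ such that (1) with $u=\sum_i\Phi_iv_i$ has exactly one solution $\mathbf y$, this solution is classical if $\mathbf y_0\in D(A)$, and $|\mathbf y(t)|\le Ce^{-\gamma t}|\mathbf y_0|$ for all $t\ge0$. 2. There is a constant $C$ such that for every $\mathbf y_0\in\tilde H$ there are $v_1,\dots,v_M\in C^2([0,\infty);\mathbb C)$ with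 $$|v_j(t)|+|v_j'(t)|+|v_j''(t)|\le Ce^{-\gamma t}|\mathbf y_0|\qquad(t>0,\ j=1,\dots,M),$$ such that (1) with $u=\sum_i\Phi_iv_i$ has exactly one solution $\mathbf y$, this solution is classical if $\mathbf y_0\in D(A)$, and $|\mathbf y(t)|\le Ce^{-\gamma t}|\mathbf y_0|$ for all $t\ge0$. -/

import Mathlib

noncomputable section

/-! ### The complexification of a real Hilbert space -/

/-- The complexification `H + iH` of a real Hilbert space `H`: pairs `(x, y)`, thought of as
`x + iy`, with `‖x + iy‖² = ‖x‖² + ‖y‖²`. -/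
def Complexification (H : Type*) : Type _ := WithLp 2 (H × H)

namespace Complexification

section Basic

variable {H : Type*} [NormedAddCommGroup H]

instance : NormedAddCommGroup (Complexification H) :=
  inferInstanceAs (NormedAddCommGroup (WithLp 2 (H × H)))

instance [CompleteSpace H] : CompleteSpace (Complexification H) :=
  inferInstanceAs (CompleteSpace (WithLp 2 (H × H)))

/-- The element `x + iy`. -/
def mk (x y : H) : Complexification H := WithLp.toLp 2 (x, y)

/-- The real part. -/
def re (z : Complexification H) : H := (WithLp.ofLp z).1

/-- The imaginary part. -/
def im (z : Complexification H) : H := (WithLp.ofLp z).2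

@[simp] theorem re_mk (x y : H) : (mk x y).re = x := rfl
@[simp] theorem im_mk (x y : H) : (mk x y).im = y := rfl
@[simp] theorem re_add (z w : Complexification H) : (z + w).re = z.re + w.re := rfl
@[simp] theorem im_add (z w : Complexification H) : (z + w).im = z.im + w.im := rfl
@[simp] theorem re_zero : (0 : Complexification H).re = 0 := rfl
@[simp] theorem im_zero : (0 : Complexification H).im = 0 := rfl

theorem ext' {z w : Complexification H} (h₁ : z.re = w.re) (h₂ : z.im = w.im) : z = w :=
  WithLp.ofLp_injective 2 (Prod.ext h₁ h₂)

theorem norm_sq (z : Complexification H) : ‖z‖ ^ 2 = ‖z.re‖ ^ 2 + ‖z.im‖ ^ 2 :=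
  WithLp.prod_norm_sq_eq_of_L2 (α := H) (β := H) z

end Basic

section Inner

variable {H : Type*} [NormedAddCommGroup H] [InnerProductSpace ℝ H]

/-- `(a + ib)(x + iy) = (ax - by) + i(ay + bx)`. -/
instance : SMul ℂ (Complexification H) :=
  ⟨fun c z => mk (c.re • z.re - c.im • z.im) (c.re • z.im + c.im • z.re)⟩

@[simp] theorem re_smul (c : ℂ) (z : Complexification H) :
    (c • z).re = c.re • z.re - c.im • z.im := rfl
@[simp] theorem im_smul (c : ℂ) (z : Complexification H) :
    (c • z).im = c.re • z.im + c.im • z.re := rfl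

instance : Module ℂ (Complexification H) where
  one_smul z := ext' (by simp) (by simp)
  mul_smul c d z := ext' (by simp; module) (by simp; module)
  smul_zero c := ext' (by simp) (by simp)
  smul_add c z w := ext' (by simp; module) (by simp; module)
  add_smul c d z := ext' (by simp; module) (by simp; module)
  zero_smul z := ext' (by simp) (by simp)

theorem norm_smul_eq (c : ℂ) (z : Complexification H) : ‖c • z‖ = ‖c‖ * ‖z‖ := by
  have h : ‖c • z‖ ^ 2 = (‖c‖ * ‖z‖) ^ 2 := by
    rw [mul_pow, norm_sq, norm_sq, re_smul, im_smul, norm_sub_sq_real, norm_add_sq_real,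
      Complex.sq_norm, Complex.normSq_apply]
    simp only [norm_smul, inner_smul_left, inner_smul_right, mul_pow, Real.norm_eq_abs, sq_abs,
      real_inner_comm z.re z.im, RCLike.conj_to_real]
    ring
  exact (sq_eq_sq₀ (norm_nonneg _) (by positivity)).1 h

/-- The inner product `⟨x + iy, x' + iy'⟩ = (⟨x, x'⟩ + ⟨y, y'⟩) + i (⟨x, y'⟩ - ⟨y, x'⟩)`,
conjugate linear in the first argument. -/
instance : InnerProductSpace ℂ (Complexification H) where
  norm_smul_le c z := (norm_smul_eq c z).le
  inner z w := ⟨inner ℝ z.re w.re + inner ℝ z.im w.im, inner ℝ z.re w.im - inner ℝ z.im w.re⟩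
  norm_sq_eq_re_inner z := by
    rw [norm_sq]
    simp
  conj_inner_symm z w := by
    apply Complex.ext
    · simp [real_inner_comm]
    · simp [real_inner_comm]
  add_left z w x := by
    apply Complex.ext
    · simp [inner_add_left]; ring
    · simp [inner_add_left]; ring
  smul_left z w c := by
    apply Complex.ext
    · simp [inner_add_left, inner_sub_left, inner_smul_left]; ring
    · simp [inner_add_left, inner_sub_left, inner_smul_left]; ring

/-- The inclusion of `H` into its complexification. -/
def ofReal (x : H) : Complexification H := mk x 0

/-- The complex-linear extension `x + iy ↦ Bx + iBy` of a bounded operator `B` on `H`. -/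
def mapL (B : H →L[ℝ] H) : Complexification H →L[ℂ] Complexification H :=
  LinearMap.mkContinuous
    { toFun := fun z => mk (B z.re) (B z.im)
      map_add' := fun z w => ext' (by simp) (by simp)
      map_smul' := fun c z => ext' (by simp) (by simp) }
    ‖B‖ (fun z => by
      refine (sq_le_sq₀ (norm_nonneg _) (by positivity)).1 ?_
      rw [mul_pow, norm_sq, norm_sq, mul_add, ← mul_pow, ← mul_pow]
      exact add_le_add (pow_le_pow_left₀ (norm_nonneg _) (B.le_opNorm _) 2)
        (pow_le_pow_left₀ (norm_nonneg _) (B.le_opNorm _) 2))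

/-- The complex-linear extension `x + iy ↦ Ax + iAy` of an unbounded operator `A` on `H`, with
domain `D(A) + iD(A)`. -/
def mapPMap (A : H →ₗ.[ℝ] H) : Complexification H →ₗ.[ℂ] Complexification H where
  domain :=
    { carrier := {z | z.re ∈ A.domain ∧ z.im ∈ A.domain}
      add_mem' := fun ha hb => ⟨A.domain.add_mem ha.1 hb.1, A.domain.add_mem ha.2 hb.2⟩
      zero_mem' := ⟨A.domain.zero_mem, A.domain.zero_mem⟩
      smul_mem' := fun c _ hz =>
        ⟨A.domain.sub_mem (A.domain.smul_mem _ hz.1) (A.domain.smul_mem _ hz.2),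
          A.domain.add_mem (A.domain.smul_mem _ hz.2) (A.domain.smul_mem _ hz.1)⟩ }
  toFun :=
    { toFun := fun z => mk (A ⟨z.1.re, z.2.1⟩) (A ⟨z.1.im, z.2.2⟩)
      map_add' := fun z w => ext'
        (A.map_add ⟨z.1.re, z.2.1⟩ ⟨w.1.re, w.2.1⟩) (A.map_add ⟨z.1.im, z.2.2⟩ ⟨w.1.im, w.2.2⟩)
      map_smul' := fun c z => ext'
        (by
          have h := A.map_sub (c.re • ⟨z.1.re, z.2.1⟩) (c.im • ⟨z.1.im, z.2.2⟩)
          rw [A.map_smul, A.map_smul] at h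
          exact h)
        (by
          have h := A.map_add (c.re • ⟨z.1.im, z.2.2⟩) (c.im • ⟨z.1.re, z.2.1⟩)
          rw [A.map_smul, A.map_smul] at h
          exact h) }

end Inner

end Complexification

namespace PIDE

open Set MeasureTheory

/-! ### The operator and the controlled equation -/

section Equation

variable {H : Type*} [NormedAddCommGroup H] [InnerProductSpace ℝ H]

/-- Some real `r` lies in the resolvent set of `A` and `(r I - A)⁻¹` is a compact operator on the
whole space. -/
def HasCompactResolvent (A : H →ₗ.[ℝ] H) : Prop :=
  ∃ (r : ℝ) (K : H →L[ℝ] H), IsCompactOperator K ∧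
    (∀ x : H, ∃ h : K x ∈ A.domain, r • K x - A ⟨K x, h⟩ = x) ∧
    (∀ x : A.domain, K (r • (x : H) - A x) = x)

/-- The memory kernel: the solution of `β' + δ β = 0`, `β(0) = 1`. -/
def kernel (δ t : ℝ) : ℝ := Real.exp (-(δ * t))

/-- `y` is the (weak, equivalently mild) solution, on `[0, ∞)` and in the complexified space, of
`y' + A y + ∫₀ᵗ β(t - s) A y(s) ds = f(t)`, `y(0) = y₀`: it is continuous and
`d/dt ⟨y, ψ⟩ + ⟨y, A ψ⟩ + ∫₀ᵗ β(t - s) ⟨y(s), A ψ⟩ ds = ⟨f(t), ψ⟩` for all `ψ ∈ D(A)`. -/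
structure IsWeakSolution (A : H →ₗ.[ℝ] H) (δ : ℝ) (f : ℝ → Complexification H)
    (y₀ : Complexification H) (y : ℝ → Complexification H) : Prop where
  continuousOn : ContinuousOn y (Ici 0)
  initial : y 0 = y₀
  weak_eq : ∀ (ψ : (Complexification.mapPMap A).domain) (t : ℝ), 0 ≤ t →
    HasDerivWithinAt (fun s => inner ℂ (ψ : Complexification H) (y s))
      (inner ℂ (ψ : Complexification H) (f t)
        - inner ℂ (Complexification.mapPMap A ψ) (y t)
        - ∫ s in (0 : ℝ)..t,
            (kernel δ (t - s) : ℂ) * inner ℂ (Complexification.mapPMap A ψ) (y s))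
      (Ici 0) t

/-- `y ∈ C¹([0, ∞); H + iH) ∩ C([0, ∞); D(A))` is a classical solution of
`y' + A y + ∫₀ᵗ β(t - s) A y(s) ds = f(t)`, `y(0) = y₀`. Here `z(t) = A y(t)`, and continuity with
values in `D(A)` refers to the graph norm. -/
def IsClassicalSolution (A : H →ₗ.[ℝ] H) (δ : ℝ) (f : ℝ → Complexification H)
    (y₀ : Complexification H) (y : ℝ → Complexification H) : Prop :=
  ContDiffOn ℝ 1 y (Ici 0) ∧ y 0 = y₀ ∧
    ∃ z : ℝ → Complexification H, ContinuousOn z (Ici 0) ∧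
      (∀ t : ℝ, 0 ≤ t → (y t, z t) ∈ (Complexification.mapPMap A).graph) ∧
      ∀ t : ℝ, 0 ≤ t →
        HasDerivWithinAt y
          (f t - z t - ∫ s in (0 : ℝ)..t, (kernel δ (t - s) : ℂ) • z s) (Ici 0) t

/-- The controlled equation `y' + A y + ∫₀ᵗ β(t - s) A y(s) ds = B u(t)`, `y(0) = y₀`, has exactly
one solution on `[0, ∞)`; it is classical when `y₀ ∈ D(A)`; and it satisfies
`‖y(t)‖ ≤ C e^{-γ t} ‖y₀‖` for all `t ≥ 0`. -/
def Stabilizes (A : H →ₗ.[ℝ] H) (B : H →L[ℝ] H) (δ γ C : ℝ)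
    (u : ℝ → Complexification H) (y₀ : Complexification H) : Prop :=
  ∃ y : ℝ → Complexification H,
    IsWeakSolution A δ (fun t => Complexification.mapL B (u t)) y₀ y ∧
    (∀ z : ℝ → Complexification H,
      IsWeakSolution A δ (fun t => Complexification.mapL B (u t)) y₀ z → EqOn z y (Ici 0)) ∧
    (y₀ ∈ (Complexification.mapPMap A).domain →
      IsClassicalSolution A δ (fun t => Complexification.mapL B (u t)) y₀ y) ∧
    ∀ t : ℝ, 0 ≤ t → ‖y t‖ ≤ C * Real.exp (-(γ * t)) * ‖y₀‖

/-- The control `u(t) = ∑ᵢ vᵢ(t) Φᵢ`. -/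
def control {M : ℕ} (Φ : Fin M → Complexification H) (v : Fin M → ℝ → ℂ) :
    ℝ → Complexification H :=
  fun t => ∑ i, v i t • Φ i

end Equation

/-! ### The spectral data

The eigenvalues `lam 0 ≤ lam 1 ≤ ...` of `A` are numbered from `0`. -/

/-- A complex square root of the real number `x`: `√x` if `x ≥ 0` and `i √(-x)` if `x ≤ 0`. -/
def csqrt (x : ℝ) : ℂ := (Real.sqrt x : ℂ) + (Real.sqrt (-x) : ℂ) * Complex.I

/-- `μ⁺ = (l + δ + √((l - δ)² - 4 l)) / 2`. -/
def muPlus (δ l : ℝ) : ℂ := ((l + δ : ℝ) + csqrt ((l - δ) ^ 2 - 4 * l)) / 2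

/-- `μ⁻ = (l + δ - √((l - δ)² - 4 l)) / 2`. -/
def muMinus (δ l : ℝ) : ℂ := ((l + δ : ℝ) - csqrt ((l - δ) ^ 2 - 4 * l)) / 2

/-- `N = max (N₁, N₂)`, where `N₁` (resp. `N₂`) is the largest `j ≥ 1` such that the `j`-th
eigenvalue has `Re μ⁺ ≤ γ` (resp. `Re μ⁻ ≤ γ`), and `0` if there is none. -/
def unstableDim (lam : ℕ → ℝ) (δ γ : ℝ) : ℕ :=
  max (sSup {n : ℕ | ∃ j : ℕ, n = j + 1 ∧ (muPlus δ (lam j)).re ≤ γ})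
    (sSup {n : ℕ | ∃ j : ℕ, n = j + 1 ∧ (muMinus δ (lam j)).re ≤ γ})

/-- The number of occurrences of `lam j` among the first `N` eigenvalues. -/
def multiplicity (lam : ℕ → ℝ) (N : ℕ) (j : Fin N) : ℕ :=
  Fintype.card {i : Fin N // lam i = lam j}

/-- The maximal multiplicity among the first `N` eigenvalues (`0` if `N = 0`). -/
def maxMultiplicity (lam : ℕ → ℝ) (N : ℕ) : ℕ :=
  Finset.univ.sup (multiplicity lam N)

/-! ### The control matrix and the rank conditions -/

/-- The matrix `P = (0, I; -diag(l (1 + δ)), -diag(l + δ))`, of size `2N`. -/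
def matP (lam : ℕ → ℝ) (δ : ℝ) (N : ℕ) : Matrix (Fin N ⊕ Fin N) (Fin N ⊕ Fin N) ℂ :=
  Matrix.fromBlocks 0 1
    (-Matrix.diagonal fun j : Fin N => ((lam j * (1 + δ) : ℝ) : ℂ))
    (-Matrix.diagonal fun j : Fin N => ((lam j + δ : ℝ) : ℂ))

/-- The eigenvalues of `P` in the order `-μ₁⁺, ..., -μ_N⁺, -μ₁⁻, ..., -μ_N⁻`. -/
def eigList (lam : ℕ → ℝ) (δ : ℝ) (N : ℕ) : Fin N ⊕ Fin N → ℂ :=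
  Sum.elim (fun j => -muPlus δ (lam j)) (fun j => -muMinus δ (lam j))

/-- All the eigenvalues `-μ_j^±` of `P` are semisimple: every generalized eigenvector is an
eigenvector. -/
def SemisimpleSpectrum (lam : ℕ → ℝ) (δ : ℝ) (N : ℕ) : Prop :=
  ∀ k, Module.End.maxGenEigenspace (Matrix.toLin' (matP lam δ N)) (eigList lam δ N k) =
    Module.End.eigenspace (Matrix.toLin' (matP lam δ N)) (eigList lam δ N k)

/-- An upper triangular Jordan matrix: entries `0` or `1` on the superdiagonal, `1` only between
equal diagonal entries, and zero off the two diagonals. -/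
def IsJordanMatrix {n : ℕ} (J : Matrix (Fin n) (Fin n) ℂ) : Prop :=
  (∀ i j : Fin n, i ≠ j → (i : ℕ) + 1 ≠ j → J i j = 0) ∧
    ∀ i j : Fin n, (i : ℕ) + 1 = j → J i j = 0 ∨ (J i j = 1 ∧ J i i = J j j)

/-- `J` is a Jordan matrix with diagonal `d`. As `d` lists the eigenvalues in a prescribed order,
the coordinates of one Jordan block need not be consecutive, so `J` has the usual Jordan form only
after a permutation `e` of the coordinates. -/
def IsJordanWithDiag {ι : Type*} (d : ι → ℂ) (J : Matrix ι ι ℂ) : Prop :=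
  (∀ k, J k k = d k) ∧
    ∃ (n : ℕ) (e : ι ≃ Fin n), IsJordanMatrix (Matrix.reindex e e J)

/-- The block rank condition on the transformed control matrix `Q`, of size `2N × M`: for every
distinct eigenvalue `lam j`, of multiplicity `m`, the block of the columns of the conjugate
transpose `Q^*` with an index in the group of `lam j`, and the same block in the second half of
the columns, have rank `m`. -/
def BlockRank (lam : ℕ → ℝ) {N M : ℕ} (Q : Matrix (Fin N ⊕ Fin N) (Fin M) ℂ) : Prop :=
  ∀ j : Fin N,
    (Q.conjTranspose.submatrix id
      (fun i : {i : Fin N // lam i = lam j} => Sum.inl i.1)).rank = multiplicity lam N j ∧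
    (Q.conjTranspose.submatrix id
      (fun i : {i : Fin N // lam i = lam j} => Sum.inr i.1)).rank = multiplicity lam N j

section ControlMatrix

variable {H : Type*} [NormedAddCommGroup H] [InnerProductSpace ℝ H]

/-- The matrix `Q = (0; C)`, of size `2N × M`, with `C_{ji} = (B Φᵢ, φⱼ)`. -/
def matQ (B : H →L[ℝ] H) (φ : ℕ → H) (N : ℕ) {M : ℕ} (Φ : Fin M → Complexification H) :
    Matrix (Fin N ⊕ Fin N) (Fin M) ℂ :=
  Matrix.fromRows 0
    (Matrix.of fun (j : Fin N) (i : Fin M) =>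
      inner ℂ (Complexification.ofReal (φ j)) (Complexification.mapL B (Φ i)))

/-- The rank condition for semisimple eigenvalues, where `P = R⁻¹ D R` with
`D = diag(-μ₁⁺, ..., -μ_N⁺, -μ₁⁻, ..., -μ_N⁻)`. -/
def SemisimpleRankCondition (B : H →L[ℝ] H) (φ : ℕ → H) (lam : ℕ → ℝ) (δ : ℝ) (N : ℕ) {M : ℕ}
    (Φ : Fin M → Complexification H) : Prop :=
  ∃ R : Matrix (Fin N ⊕ Fin N) (Fin N ⊕ Fin N) ℂ, IsUnit R ∧
    matP lam δ N = R⁻¹ * Matrix.diagonal (eigList lam δ N) * R ∧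
    BlockRank lam (R * matQ B φ N Φ)

/-- The rank condition for non-semisimple eigenvalues, where `P = R⁻¹ J R` with a Jordan matrix
`J` with the diagonal `-μ₁⁺, ..., -μ_N⁺, -μ₁⁻, ..., -μ_N⁻`. -/
def JordanRankCondition (B : H →L[ℝ] H) (φ : ℕ → H) (lam : ℕ → ℝ) (δ : ℝ) (N : ℕ) {M : ℕ}
    (Φ : Fin M → Complexification H) : Prop :=
  ∃ R J : Matrix (Fin N ⊕ Fin N) (Fin N ⊕ Fin N) ℂ, IsUnit R ∧
    IsJordanWithDiag (eigList lam δ N) J ∧ matP lam δ N = R⁻¹ * J * R ∧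
    BlockRank lam (R * matQ B φ N Φ)

end ControlMatrix

end PIDE

end

/-!
In the basis of eigenvectors the equation decouples. In a mode with eigenvalue `l`, the memory
`z = ∫ β y` and `p = y + z` solve a linear 2 × 2 system whose eigenvalues are `-μ` for the
characteristic roots `μ`. The modes beyond the `N`-th decay at the rate `γ`, each by its roots, and
uniformly since for large `l` the energy `p² + (1 + δ) z²` does.

The first `N` modes are brought exactly to rest at the time `T`, by a control that is `C²` and
vanishes after `T`. This is a finite moment problem, solvable by the Hautus test: since a
characteristic root determines its eigenvalue, it is enough that, for each eigenvalue, the rows of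
the control matrix `C` at the modes with this eigenvalue are linearly independent. This follows from
the rank conditions, since the rows of `R` belonging to one eigenvalue are supported on the modes
with that eigenvalue. Such a control, together with `w = v' + δ v`, serves for both assertions.
-/

noncomputable section

namespace PIDE

open Set Filter MeasureTheory Complexification
open scoped Topology

/-! ### Convolution integrals -/

section Leibniz

variable {V : Type*} [NormedAddCommGroup V] [NormedSpace ℝ V] {F F' : ℝ → ℝ → V} {a : ℝ}

theorem hasDerivAt_intervalIntegral_left (hF : ∀ x, Continuous (F x))
    (hd : ∀ x s, HasDerivAt (fun x => F x s) (F' x s) x)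
    (hF' : Continuous (Function.uncurry F')) (b x : ℝ) :
    HasDerivAt (fun x => ∫ s in a..b, F x s) (∫ s in a..b, F' x s) x := by
  obtain ⟨K, hK⟩ := ((isCompact_Icc (a := x - 1) (b := x + 1)).prod
    (isCompact_uIcc (a := a) (b := b))).exists_bound_of_continuousOn hF'.continuousOn
  exact (intervalIntegral.hasDerivAt_integral_of_dominated_loc_of_deriv_le (bound := fun _ => K)
    (Icc_mem_nhds (sub_one_lt x) (lt_add_one x))
    (Eventually.of_forall fun y => (hF y).aestronglyMeasurable)
    ((hF x).intervalIntegrable _ _)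
    (hF'.comp (continuous_const.prodMk continuous_id)).aestronglyMeasurable
    (Eventually.of_forall fun s hs y hy => hK (y, s) ⟨hy, uIoc_subset_uIcc hs⟩)
    intervalIntegrable_const (Eventually.of_forall fun s _ y _ => hd y s)).2

theorem hasDerivAt_intervalIntegral_diagonal [CompleteSpace V]
    (hF : Continuous (Function.uncurry F))
    (hd : ∀ x s, HasDerivAt (fun x => F x s) (F' x s) x)
    (hF' : Continuous (Function.uncurry F')) (t : ℝ) :
    HasDerivAt (fun t => ∫ s in a..t, F t s) (F t t + ∫ s in a..t, F' t s) t := by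
  have hFx : ∀ x, Continuous (F x) := fun x => hF.comp (continuous_const.prodMk continuous_id)
  have span : Continuous (ContinuousLinearMap.toSpanSingleton ℝ : V → ℝ →L[ℝ] V) :=
    (ContinuousLinearMap.toSpanSingletonCLE (𝕜 := ℝ) (E := V)).continuous
  have partial_fst : Continuous fun v : ℝ × ℝ => ∫ s in a..v.2, F' v.1 s :=
    intervalIntegral.continuous_parametric_intervalIntegral_of_continuous
      (f := fun (v : ℝ × ℝ) s => F' v.1 s)
      (hF'.comp ((continuous_fst.comp continuous_fst).prodMk continuous_snd)) continuous_snd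
  have total := hasStrictFDerivAt_uncurry_coprod (𝕜 := ℝ) (u := (t, t))
    (f := fun x b : ℝ => ∫ s in a..b, F x s)
    (f₁ := fun x b => ContinuousLinearMap.toSpanSingleton ℝ (∫ s in a..b, F' x s))
    (f₂ := fun x b => ContinuousLinearMap.toSpanSingleton ℝ (F x b))
    (Eventually.of_forall fun v =>
      (hasDerivAt_intervalIntegral_left hFx hd hF' v.2 v.1).hasFDerivAt)
    (Eventually.of_forall fun v =>
      ((hFx v.1).integral_hasStrictDerivAt a v.2).hasDerivAt.hasFDerivAt)
    (span.comp partial_fst).continuousAt (span.comp hF).continuousAt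
  refine (HasFDerivAt.comp_hasDerivAt (f := fun t : ℝ => (t, t)) t total.hasFDerivAt
    ((hasDerivAt_id t).prodMk (hasDerivAt_id t))).congr_deriv ?_
  simp [Function.HasUncurry.uncurry, add_comm]

end Leibniz

section Convolution

variable {𝕜 V : Type*} [NontriviallyNormedField 𝕜] [NormedAddCommGroup V] [NormedSpace 𝕜 V]
  [NormedSpace ℝ V] {k k' : ℝ → 𝕜} {u : ℝ → V}

theorem continuous_integral_conv (hk : Continuous k) (hu : Continuous u) :
    Continuous fun t : ℝ => ∫ s in (0 : ℝ)..t, k (t - s) • u s :=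
  intervalIntegral.continuous_parametric_intervalIntegral_of_continuous
    (f := fun t s => k (t - s) • u s)
    ((hk.comp (continuous_fst.sub continuous_snd)).smul (hu.comp continuous_snd)) continuous_id

theorem hasDerivAt_integral_conv [NormedAlgebra ℝ 𝕜] [IsScalarTower ℝ 𝕜 V] [CompleteSpace V]
    (hk : ∀ t, HasDerivAt k (k' t) t) (hk' : Continuous k') (hu : Continuous u) (t : ℝ) :
    HasDerivAt (fun t : ℝ => ∫ s in (0 : ℝ)..t, k (t - s) • u s)
      (k 0 • u t + ∫ s in (0 : ℝ)..t, k' (t - s) • u s) t := by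
  have hkc : Continuous k := continuous_iff_continuousAt.2 fun t => (hk t).continuousAt
  have diff : Continuous fun v : ℝ × ℝ => v.1 - v.2 := continuous_fst.sub continuous_snd
  simpa only [sub_self] using hasDerivAt_intervalIntegral_diagonal
    (F := fun t s => k (t - s) • u s) (F' := fun t s => k' (t - s) • u s) (a := 0)
    ((hkc.comp diff).smul (hu.comp continuous_snd))
    (fun x s => ((hk (x - s)).comp_sub_const x s).smul_const (u s))
    ((hk'.comp diff).smul (hu.comp continuous_snd)) t

end Convolution

section Kernel

variable (δ : ℝ)

@[simp] theorem kernel_zero : kernel δ 0 = 1 := by simp [kernel]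

theorem hasDerivAt_kernel (t : ℝ) : HasDerivAt (kernel δ) (-(δ * kernel δ t)) t :=
  ((hasDerivAt_const_mul δ).fun_neg.exp).congr_deriv (by rw [kernel]; ring)

theorem hasDerivAt_ofReal_kernel (t : ℝ) :
    HasDerivAt (fun t => (kernel δ t : ℂ)) (-(δ * kernel δ t)) t :=
  (hasDerivAt_kernel δ t).ofReal_comp.congr_deriv (by push_cast; rfl)

@[fun_prop]
theorem continuous_kernel : Continuous (kernel δ) :=
  continuous_iff_continuousAt.2 fun t => (hasDerivAt_kernel δ t).continuousAt

/-- Multiplying by the kernel turns `z' + δ z` into a derivative. -/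
theorem integral_kernel_mul_deriv_add {z z' : ℝ → ℂ} (hz : ∀ t, HasDerivAt z (z' t) t)
    (hz' : Continuous z') (a b t : ℝ) :
    ∫ s in a..b, (kernel δ (t - s) : ℂ) * (z' s + δ * z s)
      = kernel δ (t - b) * z b - kernel δ (t - a) * z a := by
  have hzc : Continuous z := continuous_iff_continuousAt.2 fun s => (hz s).continuousAt
  have hd : ∀ s : ℝ, HasDerivAt (fun s => (kernel δ (t - s) : ℂ) * z s)
      ((kernel δ (t - s) : ℂ) * (z' s + δ * z s)) s := fun s =>
    (((hasDerivAt_ofReal_kernel δ (t - s)).comp_const_sub t s).mul (hz s)).congr_deriv (by ring)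
  exact intervalIntegral.integral_eq_sub_of_hasDerivAt (fun s _ => hd s)
    (Continuous.intervalIntegrable (by fun_prop) _ _)

end Kernel

/-! ### One mode -/

section Mode

variable {δ l : ℝ}

/-- The generator of the system `p' = (1 - l) p - (1 + δ) z`, `z' = p - (1 + δ) z`. In a mode with
eigenvalue `l` it is satisfied, without forcing, by the memory `z = ∫ β y` and by `p = y + z`,
which turns the integral equation into an ordinary one. -/
def modeGen (δ l : ℝ) : (ℝ × ℝ) →L[ℝ] (ℝ × ℝ) :=
  ((1 - l) • ContinuousLinearMap.fst ℝ ℝ ℝ - (1 + δ) • ContinuousLinearMap.snd ℝ ℝ ℝ).prod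
    (ContinuousLinearMap.fst ℝ ℝ ℝ - (1 + δ) • ContinuousLinearMap.snd ℝ ℝ ℝ)

/-- The flow of `modeGen` through `(1, 0)`, that is, through `y = 1` with an empty memory. -/
def modeState (δ l t : ℝ) : ℝ × ℝ := NormedSpace.exp (t • modeGen δ l) (1, 0)

/-- The sum `p = y + z` of a mode with initial value `1` and of its memory. -/
def modeP (δ l t : ℝ) : ℝ := (modeState δ l t).1

/-- The memory `z = ∫ β y` of a mode with initial value `1`. -/
def modeZ (δ l t : ℝ) : ℝ := (modeState δ l t).2

/-- The mode `y` itself: the solution of `y' + l y + l ∫ β y = 0`, `y(0) = 1`. -/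
def modeY (δ l t : ℝ) : ℝ := modeP δ l t - modeZ δ l t

variable (δ l)

@[simp] theorem modeP_zero : modeP δ l 0 = 1 := by simp [modeP, modeState]
@[simp] theorem modeZ_zero : modeZ δ l 0 = 0 := by simp [modeZ, modeState]
@[simp] theorem modeY_zero : modeY δ l 0 = 1 := by simp [modeY]

theorem hasDerivAt_modeState (t : ℝ) :
    HasDerivAt (modeState δ l) (modeGen δ l (modeState δ l t)) t :=
  (ContinuousLinearMap.apply ℝ (ℝ × ℝ) ((1, 0) : ℝ × ℝ)).hasFDerivAt.comp_hasDerivAt t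
    (hasDerivAt_exp_smul_const' (𝕂 := ℝ) (modeGen δ l) t)

theorem hasDerivAt_modeP (t : ℝ) :
    HasDerivAt (modeP δ l) ((1 - l) * modeP δ l t - (1 + δ) * modeZ δ l t) t :=
  (ContinuousLinearMap.fst ℝ ℝ ℝ).hasFDerivAt.comp_hasDerivAt t (hasDerivAt_modeState δ l t)

theorem hasDerivAt_modeZ (t : ℝ) :
    HasDerivAt (modeZ δ l) (modeY δ l t - δ * modeZ δ l t) t :=
  ((ContinuousLinearMap.snd ℝ ℝ ℝ).hasFDerivAt.comp_hasDerivAt t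
    (hasDerivAt_modeState δ l t)).congr_deriv (by
      change modeP δ l t - (1 + δ) * modeZ δ l t = _
      rw [modeY]
      ring)

theorem hasDerivAt_modeY (t : ℝ) : HasDerivAt (modeY δ l) (-l * modeP δ l t) t :=
  ((hasDerivAt_modeP δ l t).sub (hasDerivAt_modeZ δ l t)).congr_deriv (by rw [modeY]; ring)

theorem contDiff_modeState {n : WithTop ℕ∞} : ContDiff ℝ n (modeState δ l) :=
  have exp : ContDiff ℝ n (NormedSpace.exp : ((ℝ × ℝ) →L[ℝ] (ℝ × ℝ)) → _) :=
    contDiff_iff_contDiffAt.2 fun x => (NormedSpace.exp_analytic (𝕂 := ℝ) x).contDiffAt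
  (exp.comp (contDiff_id.smul contDiff_const)).clm_apply contDiff_const

theorem contDiff_modeP {n : WithTop ℕ∞} : ContDiff ℝ n (modeP δ l) :=
  contDiff_fst.comp (contDiff_modeState δ l)

theorem contDiff_modeZ {n : WithTop ℕ∞} : ContDiff ℝ n (modeZ δ l) :=
  contDiff_snd.comp (contDiff_modeState δ l)

@[fun_prop]
theorem continuous_modeP : Continuous (modeP δ l) := (contDiff_modeP δ l (n := 0)).continuous

@[fun_prop]
theorem continuous_modeZ : Continuous (modeZ δ l) := (contDiff_modeZ δ l (n := 0)).continuous

@[fun_prop]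
theorem continuous_modeY : Continuous (modeY δ l) :=
  (continuous_modeP δ l).sub (continuous_modeZ δ l)

theorem modeState_sub (t s : ℝ) :
    modeState δ l (t - s) = modeP δ l (-s) • modeState δ l t
      + modeZ δ l (-s) • NormedSpace.exp (t • modeGen δ l) (0, 1) := by
  let _ := NormedAlgebra.restrictScalars ℚ ℝ ((ℝ × ℝ) →L[ℝ] (ℝ × ℝ))
  have semigroup : NormedSpace.exp ((t - s) • modeGen δ l)
      = NormedSpace.exp (t • modeGen δ l) * NormedSpace.exp (-s • modeGen δ l) := by
    rw [← NormedSpace.exp_add_of_commute ((Commute.refl _).smul_left _ |>.smul_right _), ← add_smul,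
      sub_eq_add_neg]
  have state : NormedSpace.exp (-s • modeGen δ l) (1, 0)
      = modeP δ l (-s) • ((1, 0) : ℝ × ℝ) + modeZ δ l (-s) • ((0, 1) : ℝ × ℝ) := by
    ext <;> simp [modeP, modeZ, modeState]
  rw [modeState, semigroup, mul_apply_eq_comp, state, map_add, map_smul, map_smul, modeState]

theorem exists_modeY_sub (t : ℝ) :
    ∃ a : ℝ, ∀ s, modeY δ l (t - s) = modeY δ l t * modeP δ l (-s) + a * modeZ δ l (-s) := by
  set e := NormedSpace.exp (t • modeGen δ l) (0, 1)
  refine ⟨e.1 - e.2, fun s => ?_⟩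
  have sub := modeState_sub δ l t s
  have fst : modeP δ l (t - s) = _ := congrArg Prod.fst sub
  have snd : modeZ δ l (t - s) = _ := congrArg Prod.snd sub
  rw [modeY, fst, snd, modeY]
  simp only [Prod.fst_add, Prod.smul_fst, Prod.snd_add, Prod.smul_snd, smul_eq_mul, modeP, modeZ, e]
  ring

variable {δ l} {κ t : ℝ}

theorem modeEnergy_le (hδ : -1 ≤ δ) (hl : 1 - l ≤ κ) (hκ : -(1 + δ) ≤ κ) (ht : 0 ≤ t) :
    modeP δ l t ^ 2 + (1 + δ) * modeZ δ l t ^ 2 ≤ Real.exp (κ * t) ^ 2 := by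
  set g : ℝ → ℝ := fun t =>
    Real.exp (-2 * κ * t) * (modeP δ l t ^ 2 + (1 + δ) * modeZ δ l t ^ 2) with hg
  have hd : ∀ t, HasDerivAt g (Real.exp (-2 * κ * t) *
      (-(2 * (κ - (1 - l)) * modeP δ l t ^ 2)
        - 2 * (1 + δ) * (κ - -(1 + δ)) * modeZ δ l t ^ 2)) t := fun t => by
    refine (((hasDerivAt_const_mul (-2 * κ)).exp).mul (((hasDerivAt_modeP δ l t).fun_pow 2).add
      (((hasDerivAt_modeZ δ l t).fun_pow 2).const_mul (1 + δ)))).congr_deriv ?_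
    simp only [Pi.add_apply, modeY]
    push_cast
    ring
  have hanti : Antitone g := antitone_of_hasDerivAt_nonpos hd fun t => by
    have hP := mul_nonneg (sub_nonneg.2 hl) (sq_nonneg (modeP δ l t))
    have hZ := mul_nonneg (mul_nonneg (neg_le_iff_add_nonneg'.1 hδ) (sub_nonneg.2 hκ))
      (sq_nonneg (modeZ δ l t))
    exact mul_nonpos_of_nonneg_of_nonpos (Real.exp_pos _).le (by linarith)
  have hgt : g t ≤ 1 := by simpa [hg] using hanti ht
  have hexp : Real.exp (κ * t) ^ 2 * Real.exp (-2 * κ * t) = 1 := by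
    rw [← Real.exp_nat_mul, ← Real.exp_add, Real.exp_eq_one_iff]
    push_cast
    ring
  calc _ = Real.exp (κ * t) ^ 2 * g t := by rw [hg, ← mul_assoc, hexp, one_mul]
    _ ≤ _ := mul_le_of_le_one_right (sq_nonneg _) hgt

theorem abs_modeP_le (hδ : -1 ≤ δ) (hl : 1 - l ≤ κ) (hκ : -(1 + δ) ≤ κ) (ht : 0 ≤ t) :
    |modeP δ l t| ≤ Real.exp (κ * t) :=
  abs_le_of_sq_le_sq ((le_add_of_nonneg_right
    (mul_nonneg (neg_le_iff_add_nonneg'.1 hδ) (sq_nonneg _))).trans (modeEnergy_le hδ hl hκ ht))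
    (Real.exp_pos _).le

theorem abs_modeY_le (hδ : -1 < δ) (hl : 1 - l ≤ κ) (hκ : -(1 + δ) ≤ κ) (ht : 0 ≤ t) :
    |modeY δ l t| ≤ √((2 + δ) / (1 + δ)) * Real.exp (κ * t) := by
  have hδ₁ : 0 < 1 + δ := by linarith
  have hδ₂ : 0 ≤ (2 + δ) / (1 + δ) := div_nonneg (by linarith) hδ₁.le
  refine abs_le_of_sq_le_sq ?_ (by positivity)
  rw [mul_pow, Real.sq_sqrt hδ₂, div_mul_eq_mul_div, le_div_iff₀ hδ₁]
  calc modeY δ l t ^ 2 * (1 + δ)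
      = (2 + δ) * (modeP δ l t ^ 2 + (1 + δ) * modeZ δ l t ^ 2)
        - (modeP δ l t + (1 + δ) * modeZ δ l t) ^ 2 := by rw [modeY]; ring
    _ ≤ (2 + δ) * (modeP δ l t ^ 2 + (1 + δ) * modeZ δ l t ^ 2) := sub_le_self _ (sq_nonneg _)
    _ ≤ (2 + δ) * Real.exp (κ * t) ^ 2 :=
      mul_le_mul_of_nonneg_left (modeEnergy_le hδ.le hl hκ ht) (by linarith)

end Mode

/-! ### The response of a mode to a forcing term -/

section Response

/-- The response of a linear system with impulse response `m` to the initial value `c` and the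
forcing term `f`. -/
def response (m : ℝ → ℝ) (c : ℂ) (f : ℝ → ℂ) (t : ℝ) : ℂ :=
  m t * c + ∫ s in (0 : ℝ)..t, (m (t - s) : ℂ) * f s

section Linear

variable {m m₁ m₂ : ℝ → ℝ} {c : ℂ} {f : ℝ → ℂ}

@[simp] theorem response_zero (m : ℝ → ℝ) (c : ℂ) (f : ℝ → ℂ) : response m c f 0 = m 0 * c := by
  simp [response]

theorem continuous_response (hm : Continuous m) (hf : Continuous f) :
    Continuous (response m c f) :=
  ((Complex.continuous_ofReal.comp hm).mul continuous_const).add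
    (continuous_integral_conv (k := fun t => (m t : ℂ)) (Complex.continuous_ofReal.comp hm) hf)

theorem response_const_mul (a : ℝ) (t : ℝ) :
    response (fun t => a * m t) c f t = a * response m c f t := by
  simp only [response, Complex.ofReal_mul, mul_assoc, mul_add,
    intervalIntegral.integral_const_mul]

theorem response_sub (hm₁ : Continuous m₁) (hm₂ : Continuous m₂) (hf : Continuous f) (t : ℝ) :
    response (fun t => m₁ t - m₂ t) c f t = response m₁ c f t - response m₂ c f t := by
  simp only [response, Complex.ofReal_sub, sub_mul]
  rw [intervalIntegral.integral_sub (Continuous.intervalIntegrable (by fun_prop) _ _)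
    (Continuous.intervalIntegrable (by fun_prop) _ _)]
  ring

theorem hasDerivAt_response (hm : ∀ t, HasDerivAt m (m₁ t) t) (hm₁ : Continuous m₁)
    (hf : Continuous f) (t : ℝ) :
    HasDerivAt (response m c f) (m 0 * f t + response m₁ c f t) t :=
  (((hm t).ofReal_comp.mul_const c).add (hasDerivAt_integral_conv (fun t => (hm t).ofReal_comp)
    (Complex.continuous_ofReal.comp hm₁) hf t)).congr_deriv
      (by simp only [response, smul_eq_mul]; ring)

end Linear

variable (δ l : ℝ) (c : ℂ) {f : ℝ → ℂ}

theorem response_modeP (hf : Continuous f) (t : ℝ) :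
    response (modeP δ l) c f t = response (modeY δ l) c f t + response (modeZ δ l) c f t :=
  eq_add_of_sub_eq
    (response_sub (continuous_modeP δ l) (continuous_modeZ δ l) hf t).symm

theorem hasDerivAt_response_modeY (hf : Continuous f) (t : ℝ) :
    HasDerivAt (response (modeY δ l) c f) (f t - l * response (modeP δ l) c f t) t :=
  (hasDerivAt_response (hasDerivAt_modeY δ l) (by fun_prop) hf t).congr_deriv
    (by rw [response_const_mul, modeY_zero]; push_cast; ring)

theorem hasDerivAt_response_modeZ (hf : Continuous f) (t : ℝ) :
    HasDerivAt (response (modeZ δ l) c f)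
      (response (modeY δ l) c f t - δ * response (modeZ δ l) c f t) t :=
  (hasDerivAt_response (hasDerivAt_modeZ δ l) (by fun_prop) hf t).congr_deriv (by
    rw [response_sub (by fun_prop) (by fun_prop) hf, response_const_mul, modeZ_zero]
    push_cast
    ring)

theorem integral_kernel_mul_response_modeY (hf : Continuous f) (t : ℝ) :
    ∫ s in (0 : ℝ)..t, (kernel δ (t - s) : ℂ) * response (modeY δ l) c f s
      = response (modeZ δ l) c f t := by
  have hY := continuous_response (c := c) (continuous_modeY δ l) hf
  have hZ := continuous_response (c := c) (continuous_modeZ δ l) hf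
  simpa using integral_kernel_mul_deriv_add (δ := δ) (hasDerivAt_response_modeZ δ l c hf)
    (by fun_prop) 0 t t

theorem integral_kernel_mul_response_modeP (hf : Continuous f) (t : ℝ) :
    ∫ s in (0 : ℝ)..t, (kernel (1 + δ) (t - s) : ℂ) * response (modeP δ l) c f s
      = response (modeZ δ l) c f t := by
  have hY := continuous_response (c := c) (continuous_modeY δ l) hf
  have hZ := continuous_response (c := c) (continuous_modeZ δ l) hf
  have h := integral_kernel_mul_deriv_add (δ := 1 + δ) (hasDerivAt_response_modeZ δ l c hf)
    (by fun_prop) 0 t t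
  simp only [response_modeP δ l c hf]
  convert h using 1
  · congr! 3
    push_cast
    ring
  · simp

/-- By `exists_modeY_sub` the integral in the response at any time `t ≥ T` is a combination of the
two moments. -/
theorem response_modeY_eq_zero {T t : ℝ} (hf : Continuous f) (hfT : ∀ t, T ≤ t → f t = 0)
    (hP : ∫ s in (0 : ℝ)..T, (modeP δ l (-s) : ℂ) * f s = -c)
    (hZ : ∫ s in (0 : ℝ)..T, (modeZ δ l (-s) : ℂ) * f s = 0) (ht : T ≤ t) :
    response (modeY δ l) c f t = 0 := by
  obtain ⟨a, ha⟩ := exists_modeY_sub δ l t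
  have hconv : Continuous fun s : ℝ => (modeY δ l (t - s) : ℂ) * f s := by fun_prop
  have tail : ∫ s in T..t, (modeY δ l (t - s) : ℂ) * f s = 0 :=
    intervalIntegral.integral_zero_ae <| Eventually.of_forall fun s hs => by
      rw [uIoc_of_le ht] at hs
      rw [hfT s hs.1.le, mul_zero]
  have split : ∀ s : ℝ, (modeY δ l (t - s) : ℂ) * f s
      = modeY δ l t * (modeP δ l (-s) * f s) + a * (modeZ δ l (-s) * f s) := fun s => by
    rw [ha s]
    push_cast
    ring
  rw [response, ← intervalIntegral.integral_add_adjacent_intervals (hconv.intervalIntegrable 0 T)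
    (hconv.intervalIntegrable T t), tail]
  simp_rw [split]
  rw [intervalIntegral.integral_add (Continuous.intervalIntegrable (by fun_prop) _ _)
    (Continuous.intervalIntegrable (by fun_prop) _ _), intervalIntegral.integral_const_mul,
    intervalIntegral.integral_const_mul, hP, hZ]
  ring

end Response

/-! ### Characteristic roots -/

section CharRoot

/-- `μ` is a characteristic root of a mode with eigenvalue `l`: the system `modeGen δ l` has the
eigenvalue `-μ`. -/
def IsCharRoot (δ l : ℝ) (μ : ℂ) : Prop := μ ^ 2 - (l + δ) * μ + l * (1 + δ) = 0

/-- Eliminating `l` from two characteristic equations leaves `μ = 1 + δ`, which is never a root. -/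
theorem IsCharRoot.eigenvalue_unique {δ l l' : ℝ} {μ : ℂ} (hδ : 1 + δ ≠ 0)
    (h : IsCharRoot δ l μ) (h' : IsCharRoot δ l' μ) : l = l' := by
  have hprod : ((l : ℂ) - l') * (1 + δ - μ) = 0 := by
    rw [IsCharRoot] at h h'
    linear_combination h - h'
  rcases mul_eq_zero.1 hprod with heq | hμ
  · exact_mod_cast sub_eq_zero.1 heq
  · rw [IsCharRoot, ← sub_eq_zero.1 hμ] at h
    exact absurd (by exact_mod_cast (by linear_combination h : (1 + δ : ℂ) = 0)) hδ

theorem csqrt_sq (x : ℝ) : csqrt x ^ 2 = x := by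
  rcases le_total 0 x with h | h
  · rw [csqrt, Real.sqrt_eq_zero_of_nonpos (neg_nonpos.2 h), Complex.ofReal_zero, zero_mul,
      add_zero, ← Complex.ofReal_pow, Real.sq_sqrt h]
  · rw [csqrt, Real.sqrt_eq_zero_of_nonpos h, Complex.ofReal_zero, zero_add, mul_pow,
      Complex.I_sq, ← Complex.ofReal_pow, Real.sq_sqrt (neg_nonneg.2 h), Complex.ofReal_neg,
      mul_neg_one, neg_neg]

variable (δ l : ℝ)

theorem muPlus_add_muMinus : muPlus δ l + muMinus δ l = l + δ := by
  rw [muPlus, muMinus]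
  push_cast
  ring

theorem muPlus_mul_muMinus : muPlus δ l * muMinus δ l = l * (1 + δ) := by
  have h := csqrt_sq ((l - δ) ^ 2 - 4 * l)
  rw [muPlus, muMinus]
  push_cast at h ⊢
  linear_combination -h / 4

theorem isCharRoot_muPlus : IsCharRoot δ l (muPlus δ l) := by
  rw [IsCharRoot, ← muPlus_add_muMinus, ← muPlus_mul_muMinus]
  ring

theorem isCharRoot_muMinus : IsCharRoot δ l (muMinus δ l) := by
  rw [IsCharRoot, ← muPlus_add_muMinus, ← muPlus_mul_muMinus]
  ring

theorem re_csqrt (x : ℝ) : (csqrt x).re = √x := by simp [csqrt]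

theorem re_muMinus : (muMinus δ l).re = (l + δ - √((l - δ) ^ 2 - 4 * l)) / 2 := by
  rw [muMinus, Complex.div_ofNat_re, Complex.sub_re, re_csqrt, Complex.ofReal_re]

theorem re_muMinus_le_re_muPlus : (muMinus δ l).re ≤ (muPlus δ l).re := by
  rw [muMinus, muPlus, Complex.div_ofNat_re, Complex.div_ofNat_re, Complex.sub_re, Complex.add_re,
    re_csqrt]
  linarith [Real.sqrt_nonneg ((l - δ) ^ 2 - 4 * l)]

variable {δ}

/-- `Re μ⁻` tends to `1 + δ` as the eigenvalue tends to infinity. -/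
theorem eventually_lt_re_muMinus {γ : ℝ} (hγ : γ < δ + 1) :
    ∀ᶠ l in atTop, γ < (muMinus δ l).re := by
  have hγ' : 0 < δ + 1 - γ := sub_pos.2 hγ
  filter_upwards [eventually_gt_atTop (2 * γ - δ),
    eventually_gt_atTop (γ * (δ - γ) / (δ + 1 - γ))] with l hl₁ hl₂
  rw [div_lt_iff₀ hγ'] at hl₂
  have hsqrt : √((l - δ) ^ 2 - 4 * l) < l + δ - 2 * γ := by
    rw [Real.sqrt_lt' (by linarith)]
    linarith
  rw [re_muMinus]
  linarith

theorem lt_re_muMinus_of_unstableDim_le {lam : ℕ → ℝ} (hlam : Tendsto lam atTop atTop) {γ : ℝ}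
    (hγ : γ < δ + 1) {n : ℕ} (hn : unstableDim lam δ γ ≤ n) : γ < (muMinus δ (lam n)).re := by
  by_contra! hle
  obtain ⟨m, hm⟩ := eventually_atTop.1 (hlam.eventually (eventually_lt_re_muMinus hγ))
  have hbdd : BddAbove {n : ℕ | ∃ j : ℕ, n = j + 1 ∧ (muMinus δ (lam j)).re ≤ γ} := by
    refine ⟨m, ?_⟩
    rintro _ ⟨j, rfl, hj⟩
    exact not_lt.1 fun hmj => hj.not_gt (hm j (Nat.lt_succ_iff.1 hmj))
  have hlt : n + 1 ≤ unstableDim lam δ γ := (le_csSup hbdd ⟨n, rfl, hle⟩).trans (le_max_right _ _)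
  exact absurd hn (not_le.2 hlt)

end CharRoot

/-! ### Decay of the stable modes -/

section Decay

variable {δ l : ℝ}

theorem hasDerivAt_cexp_mul (μ : ℂ) (t : ℝ) :
    HasDerivAt (fun t : ℝ => Complex.exp (μ * t)) (μ * Complex.exp (μ * t)) t := by
  simpa [mul_comm] using ((hasDerivAt_id t).ofReal_comp.const_mul μ).cexp

theorem norm_cexp_mul_ofReal (μ : ℂ) (t : ℝ) : ‖Complex.exp (μ * t)‖ = Real.exp (μ.re * t) := by
  rw [Complex.norm_exp, Complex.re_mul_ofReal]

variable (δ l)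

/-- Diagonalization of the mode: `(1, μ⁻ - 1 - δ)` is a left eigenvector of `modeGen δ l`. -/
theorem modeP_add_mul_modeZ (t : ℝ) :
    (modeP δ l t : ℂ) + (muMinus δ l - 1 - δ) * modeZ δ l t = Complex.exp (-muPlus δ l * t) := by
  set q : ℝ → ℂ := fun t => modeP δ l t + (muMinus δ l - 1 - δ) * modeZ δ l t with hq
  have hqd : ∀ t : ℝ, HasDerivAt q (-muPlus δ l * q t) t := fun t => by
    refine ((hasDerivAt_modeP δ l t).ofReal_comp.add
      ((hasDerivAt_modeZ δ l t).ofReal_comp.const_mul _)).congr_deriv ?_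
    simp only [hq, modeY]
    push_cast
    linear_combination (modeP δ l t - (1 + δ) * modeZ δ l t : ℂ) * muPlus_add_muMinus δ l
      + (modeZ δ l t : ℂ) * muPlus_mul_muMinus δ l
  have hd : ∀ t : ℝ, HasDerivAt (fun t : ℝ => Complex.exp (muPlus δ l * t) * q t) 0 t := fun t =>
    ((hasDerivAt_cexp_mul _ t).mul (hqd t)).congr_deriv (by ring)
  have hconst := is_const_of_deriv_eq_zero (fun t => (hd t).differentiableAt)
    (fun t => (hd t).deriv) t 0
  rw [neg_mul, Complex.exp_neg]
  exact eq_inv_of_mul_eq_one_right (by simpa [hq] using hconst)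

variable {t : ℝ}

theorem abs_modeZ_le_mul_exp (ht : 0 ≤ t) :
    |modeZ δ l t| ≤ t * Real.exp (-((muMinus δ l).re * t)) := by
  have hd : ∀ s : ℝ, HasDerivAt (fun s : ℝ => Complex.exp (muMinus δ l * s) * modeZ δ l s)
      (Complex.exp (muMinus δ l * s) * Complex.exp (-muPlus δ l * s)) s := fun s => by
    refine ((hasDerivAt_cexp_mul _ s).mul (hasDerivAt_modeZ δ l s).ofReal_comp).congr_deriv ?_
    rw [← modeP_add_mul_modeZ, modeY]
    push_cast
    ring
  have hbound : ∀ s ∈ Ico 0 t,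
      ‖Complex.exp (muMinus δ l * s) * Complex.exp (-muPlus δ l * s)‖ ≤ 1 := fun s hs => by
    rw [norm_mul, norm_cexp_mul_ofReal, norm_cexp_mul_ofReal, ← Real.exp_add,
      Real.exp_le_one_iff, ← add_mul, Complex.neg_re]
    exact mul_nonpos_of_nonpos_of_nonneg
      (by linarith [re_muMinus_le_re_muPlus δ l]) hs.1
  have h := norm_image_sub_le_of_norm_deriv_le_segment' (fun s _ => (hd s).hasDerivWithinAt)
    hbound t ⟨ht, le_rfl⟩
  simp only [modeZ_zero, Complex.ofReal_zero, mul_zero, sub_zero, one_mul, norm_mul,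
    norm_cexp_mul_ofReal, Complex.norm_real, Real.norm_eq_abs] at h
  rwa [Real.exp_neg, ← div_eq_mul_inv, le_div_iff₀' (Real.exp_pos _)]

variable {δ l}

theorem mul_exp_neg_le {r γ : ℝ} (h : γ < r) (t : ℝ) :
    t * Real.exp (-(r * t)) ≤ (r - γ)⁻¹ * Real.exp (-(γ * t)) := by
  have hle : t ≤ (r - γ)⁻¹ * Real.exp ((r - γ) * t) := by
    rw [inv_mul_eq_div, le_div_iff₀' (sub_pos.2 h)]
    linarith [Real.add_one_le_exp ((r - γ) * t)]
  refine (mul_le_mul_of_nonneg_right hle (Real.exp_pos _).le).trans_eq ?_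
  rw [mul_assoc, ← Real.exp_add]
  ring_nf

theorem exists_abs_modeY_le {γ : ℝ} (h : γ < (muMinus δ l).re) :
    ∃ K : ℝ, ∀ t, 0 ≤ t → |modeY δ l t| ≤ K * Real.exp (-(γ * t)) := by
  refine ⟨1 + ‖muMinus δ l - δ‖ * ((muMinus δ l).re - γ)⁻¹, fun t ht => ?_⟩
  have hq : ‖Complex.exp (-muPlus δ l * t)‖ ≤ Real.exp (-(γ * t)) := by
    rw [norm_cexp_mul_ofReal, Complex.neg_re, neg_mul]
    have := mul_le_mul_of_nonneg_right (h.le.trans (re_muMinus_le_re_muPlus δ l)) ht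
    gcongr
  have hz := (abs_modeZ_le_mul_exp δ l ht).trans (mul_exp_neg_le h t)
  have hY : (modeY δ l t : ℂ) = Complex.exp (-muPlus δ l * t)
      - (muMinus δ l - δ) * modeZ δ l t := by
    rw [← modeP_add_mul_modeZ, modeY]
    push_cast
    ring
  calc |modeY δ l t| = ‖(modeY δ l t : ℂ)‖ := by rw [Complex.norm_real, Real.norm_eq_abs]
    _ ≤ ‖Complex.exp (-muPlus δ l * t)‖ + ‖muMinus δ l - δ‖ * |modeZ δ l t| := by
      rw [hY, ← Real.norm_eq_abs, ← Complex.norm_real, ← norm_mul]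
      exact norm_sub_le _ _
    _ ≤ Real.exp (-(γ * t))
        + ‖muMinus δ l - δ‖ * (((muMinus δ l).re - γ)⁻¹ * Real.exp (-(γ * t))) := by gcongr
    _ = _ := by ring

/-- The large eigenvalues are controlled by the energy, the finitely many others one by one. -/
theorem exists_forall_abs_modeY_le (hδ : -1 < δ) {lam : ℕ → ℝ} (hlam : Tendsto lam atTop atTop)
    {γ : ℝ} (hγ : γ < δ + 1) :
    ∃ K : ℝ, ∀ n, unstableDim lam δ γ ≤ n → ∀ t, 0 ≤ t →
      |modeY δ (lam n) t| ≤ K * Real.exp (-(γ * t)) := by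
  have hmode : ∀ n, ∃ K : ℝ, unstableDim lam δ γ ≤ n → ∀ t, 0 ≤ t →
      |modeY δ (lam n) t| ≤ K * Real.exp (-(γ * t)) := fun n => by
    by_cases hn : unstableDim lam δ γ ≤ n
    · obtain ⟨K, hK⟩ := exists_abs_modeY_le (lt_re_muMinus_of_unstableDim_le hlam hγ hn)
      exact ⟨K, fun _ => hK⟩
    · exact ⟨0, fun h => absurd h hn⟩
  choose K hK using hmode
  obtain ⟨m, hm⟩ := eventually_atTop.1 (hlam.eventually_ge_atTop (2 + δ))
  have hsum : 0 ≤ ∑ n ∈ Finset.range m, |K n| := Finset.sum_nonneg fun n _ => abs_nonneg _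
  refine ⟨√((2 + δ) / (1 + δ)) + ∑ n ∈ Finset.range m, |K n|, fun n hn t ht => ?_⟩
  rcases lt_or_ge n m with hnm | hnm
  · refine (hK n hn t ht).trans (mul_le_mul_of_nonneg_right ?_ (Real.exp_pos _).le)
    exact (le_abs_self _).trans ((Finset.single_le_sum (f := fun n => |K n|)
      (fun n _ => abs_nonneg _) (Finset.mem_range.2 hnm)).trans
        (le_add_of_nonneg_left (Real.sqrt_nonneg _)))
  · refine (abs_modeY_le (κ := -(1 + δ)) hδ (by linarith [hm n hnm]) le_rfl ht).trans
      (mul_le_mul (le_add_of_nonneg_right hsum) (Real.exp_le_exp.2 ?_) (Real.exp_pos _).le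
        (by positivity))
    linarith [mul_le_mul_of_nonneg_right (show γ ≤ 1 + δ by linarith) ht]

end Decay

/-! ### Growth of the eigenvalues -/

section Growth

theorem exists_norm_compact_apply_lt {𝕜 E F : Type*} [RCLike 𝕜] [NormedAddCommGroup E]
    [NormedSpace 𝕜 E] [NormedAddCommGroup F] [InnerProductSpace 𝕜 F] {K : E →L[𝕜] F}
    (hK : IsCompactOperator K) {x : ℕ → E} {r : ℝ} (hx : ∀ n, ‖x n‖ ≤ r)
    (horth : Pairwise fun n m => inner 𝕜 (K (x n)) (K (x m)) = 0) {ε : ℝ} (hε : 0 < ε) :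
    ∃ n, ‖K (x n)‖ < ε := by
  by_contra! hlow
  obtain ⟨y, -, ψ, hψ, hy⟩ := (hK.isCompact_closure_image_closedBall
    (f := (K : E →ₗ[𝕜] F)) r).tendsto_subseq (x := fun n => K (x n)) fun n =>
      subset_closure ⟨x n, mem_closedBall_zero_iff.2 (hx n), rfl⟩
  have hinner : inner 𝕜 y y = 0 := by
    refine tendsto_nhds_unique (hy.inner (hy.comp (tendsto_add_atTop_nat 1)))
      (tendsto_const_nhds.congr fun n => (horth (hψ n.lt_succ_self).ne).symm)
  have hle : ε ≤ ‖y‖ := ge_of_tendsto' hy.norm fun n => hlow _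
  rw [inner_self_eq_zero.1 hinner, norm_zero] at hle
  exact hε.not_ge hle

variable {H : Type*} [NormedAddCommGroup H] [InnerProductSpace ℝ H] {A : H →ₗ.[ℝ] H}
  {φ : ℕ → H} {lam : ℕ → ℝ}

theorem HasCompactResolvent.exists_lt_abs_eigenvalue (hA : HasCompactResolvent A)
    (hφo : Orthonormal ℝ φ) (hφ : ∀ n, ∃ h : φ n ∈ A.domain, A ⟨φ n, h⟩ = lam n • φ n) (L : ℝ) :
    ∃ n, L < |lam n| := by
  obtain ⟨r, K, hK, -, hKA⟩ := hA
  have hKφ : ∀ n, (r - lam n) • K (φ n) = φ n := fun n => by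
    obtain ⟨h, hn⟩ := hφ n
    simpa only [hn, ← sub_smul, map_smul] using hKA ⟨φ n, h⟩
  have hne : ∀ n, r - lam n ≠ 0 := fun n h => hφo.ne_zero n (by rw [← hKφ n, h, zero_smul])
  have hinv : ∀ n, K (φ n) = (r - lam n)⁻¹ • φ n := fun n => (eq_inv_smul_iff₀ (hne n)).2 (hKφ n)
  obtain ⟨n, hn⟩ := exists_norm_compact_apply_lt hK (fun n => (hφo.1 n).le)
    (fun n m hnm => by
      simp only [hinv, inner_smul_left, inner_smul_right, hφo.2 hnm, mul_zero])
    (show 0 < (|r| + |L| + 1)⁻¹ by positivity)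
  rw [hinv, norm_smul, hφo.1, mul_one, norm_inv, Real.norm_eq_abs,
    inv_lt_inv₀ (abs_pos.2 (hne n)) (by positivity)] at hn
  exact ⟨n, by linarith [abs_sub r (lam n), le_abs_self L]⟩

theorem HasCompactResolvent.tendsto_eigenvalues (hA : HasCompactResolvent A)
    (hφo : Orthonormal ℝ φ) (hφ : ∀ n, ∃ h : φ n ∈ A.domain, A ⟨φ n, h⟩ = lam n • φ n)
    (hlam : Monotone lam) : Tendsto lam atTop atTop := by
  refine tendsto_atTop_atTop_of_monotone hlam fun b => ?_
  obtain ⟨n, hn⟩ := hA.exists_lt_abs_eigenvalue hφo hφ (max |lam 0| b)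
  obtain ⟨h₀, hb⟩ := max_lt_iff.1 hn
  refine ⟨n, (hb.trans_eq (abs_of_nonneg ?_)).le⟩
  by_contra! hneg
  rw [abs_of_neg hneg] at h₀
  linarith [neg_abs_le (lam 0), hlam n.zero_le]

end Growth

/-! ### The moment problem -/

section Moments

variable {ι κ : Type*} {T : ℝ}

/-- The tuples of `C²` scalar controls that are at rest from the time `T` on. -/
def vanishingControls (κ : Type*) (T : ℝ) : Submodule ℂ (κ → ℝ → ℂ) where
  carrier := {v | ∀ i, ContDiff ℝ 2 (v i) ∧ ∀ t, T ≤ t → v i t = 0}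
  add_mem' hv hw i := ⟨(hv i).1.add (hw i).1, fun t ht => by
    rw [Pi.add_apply, Pi.add_apply, (hv i).2 t ht, (hw i).2 t ht, add_zero]⟩
  zero_mem' _ := ⟨contDiff_const, fun _ _ => rfl⟩
  smul_mem' c v hv i := ⟨contDiff_const.mul (hv i).1, fun t ht => by
    rw [Pi.smul_apply, Pi.smul_apply, (hv i).2 t ht, smul_zero]⟩

theorem continuous_coe_vanishingControls (v : vanishingControls κ T) (i : κ) :
    Continuous (v.1 i) := (v.2 i).1.continuous

theorem iteratedDeriv_eq_zero_of_forall_ge {E : Type*} [NormedAddCommGroup E] [NormedSpace ℝ E]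
    {f : ℝ → E} {n : ℕ} (hf : ContDiff ℝ n f) (hfT : ∀ t, T ≤ t → f t = 0) {t : ℝ} (ht : T ≤ t) :
    iteratedDeriv n f t = 0 := by
  rw [← iteratedDerivWithin_eq_iteratedDeriv (uniqueDiffOn_Ici T) hf.contDiffAt ht,
    iteratedDerivWithin_congr (s := Ici T) (g := fun _ => 0) hfT ht,
    iteratedDerivWithin_const, ite_self]

variable [Fintype κ]

/-- The test control is the conjugate of `g` times a smooth cutoff at `T`. -/
theorem eq_zero_of_forall_integral_vanishingControls_eq_zero (hT : 0 < T) {g : κ → ℝ → ℂ}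
    (hg : ∀ i, ContDiff ℝ 2 (g i))
    (h : ∀ v ∈ vanishingControls κ T, ∫ s in (0 : ℝ)..T, ∑ i, g i s * v i s = 0) (i : κ) {s : ℝ}
    (hs : s ∈ Ico 0 T) : g i s = 0 := by
  set η : ℝ → ℝ := fun s => Real.smoothTransition (T - s) with hη
  have hη2 : ContDiff ℝ 2 η := Real.smoothTransition.contDiff.comp (contDiff_const.sub contDiff_id)
  have htest : (fun i s => η s * (starRingEnd ℂ) (g i s)) ∈ vanishingControls κ T := fun i =>
    ⟨(Complex.ofRealCLM.contDiff.comp hη2).mul (Complex.conjCLE.contDiff.comp (hg i)),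
      fun t ht => by
        simp only [hη, Real.smoothTransition.zero_of_nonpos (sub_nonpos.2 ht),
          Complex.ofReal_zero, zero_mul]⟩
  set E : ℝ → ℝ := fun s => η s * ∑ i, ‖g i s‖ ^ 2 with hE
  have hEc : Continuous E := hη2.continuous.mul
    (continuous_finsetSum _ fun i _ => (hg i).continuous.norm.pow 2)
  have hE0 : ∫ s in (0 : ℝ)..T, E s = 0 := by
    rw [← Complex.ofReal_eq_zero, ← intervalIntegral.integral_ofReal, ← h _ htest]
    refine intervalIntegral.integral_congr fun s _ => ?_
    simp only [hE, Complex.ofReal_mul, Complex.ofReal_sum, Complex.ofReal_pow, Finset.mul_sum]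
    exact Finset.sum_congr rfl fun i _ => by rw [← Complex.mul_conj']; ring
  by_contra hne
  refine (intervalIntegral.integral_pos hT hEc.continuousOn (fun s _ => ?_)
    ⟨s, ⟨hs.1, hs.2.le⟩, ?_⟩).ne' hE0
  · exact mul_nonneg (Real.smoothTransition.nonneg _) (Finset.sum_nonneg fun i _ => sq_nonneg _)
  · refine mul_pos (Real.smoothTransition.pos_of_pos (sub_pos.2 hs.2)) ?_
    exact Finset.sum_pos' (fun i _ => sq_nonneg _)
      ⟨i, Finset.mem_univ _, pow_pos (norm_pos_iff.2 hne) 2⟩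

/-- The map taking a control `v` to its moments `∫₀ᵀ ∑ᵢ θₖᵢ vᵢ`. -/
def moments (θ : ι → κ → ℝ → ℂ) (hθ : ∀ k i, Continuous (θ k i)) :
    vanishingControls κ T →ₗ[ℂ] ι → ℂ where
  toFun v k := ∫ s in (0 : ℝ)..T, ∑ i, θ k i s * v.1 i s
  map_add' v w := funext fun k => by
    have hc : ∀ v : vanishingControls κ T, Continuous fun s => ∑ i, θ k i s * v.1 i s := fun v =>
      continuous_finsetSum _ fun i _ => (hθ k i).mul (continuous_coe_vanishingControls v i)
    rw [Pi.add_apply, ← intervalIntegral.integral_add ((hc v).intervalIntegrable _ _)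
      ((hc w).intervalIntegrable _ _)]
    simp only [Submodule.coe_add, Pi.add_apply, mul_add, Finset.sum_add_distrib]
  map_smul' c v := funext fun k => by
    rw [Pi.smul_apply, RingHom.id_apply, ← intervalIntegral.integral_smul]
    simp only [Submodule.coe_smul, Pi.smul_apply, smul_eq_mul, Finset.mul_sum, mul_left_comm]

variable [Fintype ι]

theorem moments_surjective (hT : 0 < T) {θ : ι → κ → ℝ → ℂ} (hθ : ∀ k i, ContDiff ℝ 2 (θ k i))
    (hindep : ∀ a : ι → ℂ, (∀ i, ∀ s ∈ Ico 0 T, ∑ k, a k * θ k i s = 0) → a = 0) :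
    Function.Surjective (moments (T := T) θ fun k i => (hθ k i).continuous) := by
  classical
  set L := moments (T := T) θ fun k i => (hθ k i).continuous
  rw [← LinearMap.range_eq_top]
  by_contra hne
  obtain ⟨f, hf0, hf⟩ := Submodule.exists_le_ker_of_lt_top _ (lt_top_iff_ne_top.2 hne)
  set a : ι → ℂ := fun k => f fun j => if k = j then 1 else 0
  have hfa : ∀ w, f w = ∑ k, a k * w k := fun w => by
    rw [LinearMap.pi_apply_eq_sum_univ f w]
    exact Finset.sum_congr rfl fun k _ => mul_comm _ _
  have ha : a = 0 := hindep a fun i s hs =>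
    eq_zero_of_forall_integral_vanishingControls_eq_zero hT
      (g := fun i s => ∑ k, a k * θ k i s)
      (fun i => ContDiff.sum fun k _ => contDiff_const.mul (hθ k i))
      (fun v hv => by
        have hcont : ∀ k, Continuous fun s => a k * ∑ i, θ k i s * v i s := fun k =>
          continuous_const.mul (continuous_finsetSum _ fun i _ =>
            (hθ k i).continuous.mul (hv i).1.continuous)
        have hfL : f (L ⟨v, hv⟩) = 0 := hf ⟨_, rfl⟩
        rw [hfa] at hfL
        rw [← hfL]
        simp only [L, moments, LinearMap.coe_mk, AddHom.coe_mk,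
          ← intervalIntegral.integral_const_mul]
        rw [← intervalIntegral.integral_finsetSum fun k _ => (hcont k).intervalIntegrable _ _]
        simp only [Finset.mul_sum, Finset.sum_mul, mul_assoc]
        exact intervalIntegral.integral_congr fun s _ => Finset.sum_comm) i hs
  exact hf0 (LinearMap.ext fun w => by simp [hfa, ha])

end Moments

section Bound

variable {ι κ : Type*} {T : ℝ}

theorem exists_forall_norm_apply_le [Fintype ι] {τ : Type*} {ℓ : τ → (ι → ℂ) →ₗ[ℂ] ℂ}
    {g : τ → ℝ} (h : ∀ w, ∃ K, ∀ x, ‖ℓ x w‖ ≤ K * g x) :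
    ∃ K, ∀ x w, ‖ℓ x w‖ ≤ K * g x * ‖w‖ := by
  classical
  choose K hK using fun k : ι => h (fun j => if k = j then 1 else 0)
  refine ⟨∑ k, K k, fun x w => ?_⟩
  rw [LinearMap.pi_apply_eq_sum_univ (ℓ x) w, Finset.sum_mul, Finset.sum_mul]
  refine norm_sum_le_of_le _ fun k _ => ?_
  rw [norm_smul, mul_comm]
  exact mul_le_mul (hK k x) (norm_le_pi_norm w k) (norm_nonneg _)
    ((norm_nonneg _).trans (hK k x))

/-- The `j`-th derivative, `j ≤ 2`, of the `i`-th component of a control at the time `t`. -/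
def controlDeriv (j : Fin 3) (i : κ) (t : ℝ) : vanishingControls κ T →ₗ[ℂ] ℂ where
  toFun v := iteratedDeriv j (v.1 i) t
  map_add' v w := iteratedDeriv_add (((v.2 i).1.of_le (by exact_mod_cast j.is_le)).contDiffAt)
    (((w.2 i).1.of_le (by exact_mod_cast j.is_le)).contDiffAt)
  map_smul' c v := iteratedDeriv_const_smul_field c (v.1 i)

theorem exists_norm_controlDeriv_le [Finite κ] (v : vanishingControls κ T) {g : ℝ → ℝ}
    (hgc : Continuous g) (hg : ∀ t, 0 < g t) :
    ∃ K, ∀ x : Fin 3 × κ × Ici (0 : ℝ), ‖controlDeriv x.1 x.2.1 x.2.2 v‖ ≤ K * g x.2.2 := by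
  have hcomp : ∀ j : Fin 3, ∀ i, ∃ K, ∀ t ∈ Ici (0 : ℝ), ‖controlDeriv j i t v‖ ≤ K * g t := by
    intro j i
    have hv := (v.2 i).1.of_le (m := (j : ℕ)) (by exact_mod_cast j.is_le)
    obtain ⟨K, hK⟩ := isCompact_Icc (a := 0) (b := T) |>.exists_bound_of_continuousOn
      (f := fun t => ‖controlDeriv j i t v‖ / g t) (Continuous.continuousOn <|
        (hv.continuous_iteratedDeriv j le_rfl).norm.div₀ hgc fun t => (hg t).ne')
    refine ⟨max K 0, fun t ht => ?_⟩
    rcases le_total t T with htT | htT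
    · exact ((div_le_iff₀ (hg t)).1 ((le_abs_self _).trans (hK t ⟨ht, htT⟩))).trans
        (mul_le_mul_of_nonneg_right (le_max_left _ _) (hg t).le)
    · rw [controlDeriv, LinearMap.coe_mk, AddHom.coe_mk,
        iteratedDeriv_eq_zero_of_forall_ge hv (v.2 i).2 htT, norm_zero]
      exact mul_nonneg (le_max_right _ _) (hg t).le
  choose K hK using hcomp
  obtain ⟨b, hb⟩ := (Set.finite_range fun x : Fin 3 × κ => K x.1 x.2).bddAbove
  exact ⟨b, fun x => (hK x.1 x.2.1 _ x.2.2.2).trans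
    (mul_le_mul_of_nonneg_right (hb ⟨(x.1, x.2.1), rfl⟩) (hg _).le)⟩

theorem exists_forall_norm_derivs_le [Fintype ι] [Finite κ]
    (R : (ι → ℂ) →ₗ[ℂ] vanishingControls κ T) {g : ℝ → ℝ} (hgc : Continuous g)
    (hg : ∀ t, 0 < g t) :
    ∃ K, ∀ w i t, 0 ≤ t → ‖(R w).1 i t‖ + ‖deriv ((R w).1 i) t‖
      + ‖deriv (deriv ((R w).1 i)) t‖ ≤ K * g t * ‖w‖ := by
  obtain ⟨K, hK⟩ := exists_forall_norm_apply_le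
    (ℓ := fun x : Fin 3 × κ × Ici (0 : ℝ) => controlDeriv x.1 x.2.1 x.2.2 ∘ₗ R)
    (g := fun x => g x.2.2)
    fun w => exists_norm_controlDeriv_le (R w) hgc hg
  refine ⟨3 * K, fun w i t ht => ?_⟩
  have h₀ := hK (0, i, ⟨t, ht⟩) w
  have h₁ := hK (1, i, ⟨t, ht⟩) w
  have h₂ := hK (2, i, ⟨t, ht⟩) w
  simp only [LinearMap.comp_apply, controlDeriv, LinearMap.coe_mk, AddHom.coe_mk,
    Fin.val_zero, Fin.val_one, Fin.val_two, iteratedDeriv_zero,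
    iteratedDeriv_succ] at h₀ h₁ h₂
  linarith

end Bound

/-! ### Null controllability of finitely many modes -/

section Hautus

variable {ι κ : Type*} {δ T : ℝ} {lam : ι → ℝ} {C : Matrix ι κ ℂ}

/-- The Hautus test for the modes with the eigenvalues `lam` under the control matrix `C`: modes
with the same eigenvalue have linearly independent rows. It decides controllability because a
characteristic root determines its eigenvalue, see `IsCharRoot.eigenvalue_unique`. -/
def HautusCondition (lam : ι → ℝ) (C : Matrix ι κ ℂ) : Prop :=
  ∀ l, LinearIndepOn ℂ C {n | lam n = l}

/-- The adjoint of the generator of the modes with the eigenvalues `lam`, in the coordinates dual to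
those of `modeGen`. -/
def adjointGen (δ : ℝ) (lam : ι → ℝ) : Module.End ℂ (ι → ℂ × ℂ) :=
  LinearMap.pi fun n =>
    (((1 - lam n : ℂ) • LinearMap.fst ℂ ℂ ℂ + LinearMap.snd ℂ ℂ ℂ).prod
      (-(1 + δ : ℂ) • (LinearMap.fst ℂ ℂ ℂ + LinearMap.snd ℂ ℂ ℂ))) ∘ₗ LinearMap.proj n

theorem adjointGen_apply (x : ι → ℂ × ℂ) (n : ι) : adjointGen δ lam x n =
    ((1 - lam n) * (x n).1 + (x n).2, -(1 + δ) * ((x n).1 + (x n).2)) := rfl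

theorem isCharRoot_neg_of_adjointGen_eq_smul {ν : ℂ} {x : ι → ℂ × ℂ}
    (hx : adjointGen δ lam x = ν • x) {n : ι} (hn : (x n).1 ≠ 0) : IsCharRoot δ (lam n) (-ν) := by
  have h₁ : (1 - lam n) * (x n).1 + (x n).2 = ν * (x n).1 := congrArg Prod.fst (congrFun hx n)
  have h₂ : -(1 + δ) * ((x n).1 + (x n).2) = ν * (x n).2 := congrArg Prod.snd (congrFun hx n)
  rw [IsCharRoot]
  refine (mul_eq_zero.1 ?_).resolve_right hn
  linear_combination (-(ν + 1 + δ)) * h₁ - h₂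

variable [Fintype ι]

theorem HautusCondition.eq_zero (hC : HautusCondition lam C) {l : ℝ} {a : ι → ℂ}
    (ha : ∀ n, a n ≠ 0 → lam n = l) (haC : ∀ i, ∑ n, a n * C n i = 0) : a = 0 := by
  classical
  have hmem : ∀ n ∉ Finset.univ.filter (lam · = l), a n = 0 := fun n hn =>
    of_not_not fun han => hn (Finset.mem_filter.2 ⟨Finset.mem_univ n, ha n han⟩)
  have hsum : ∑ n with lam n = l, a n • C n = 0 := funext fun i => by
    rw [Finset.sum_subset (Finset.subset_univ _) fun n _ hn => by rw [hmem n hn, zero_smul],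
      Finset.sum_apply]
    exact haC i
  have hzero := linearIndepOn_iff''.1 (hC l) (Finset.univ.filter (lam · = l)) a
    (fun n hn => (Finset.mem_filter.1 hn).2) hmem hsum
  exact funext fun n => by_contra fun han =>
    han (hzero n (Finset.mem_filter.2 ⟨Finset.mem_univ n, ha n han⟩))

/-- The `i`-th output at the time `-s` of the dual system with the final state `x`. -/
def observation (δ : ℝ) (lam : ι → ℝ) (C : Matrix ι κ ℂ) (i : κ) (s : ℝ) :
    (ι → ℂ × ℂ) →ₗ[ℂ] ℂ :=
  ∑ n, C n i • ((modeP δ (lam n) (-s) : ℂ) • LinearMap.fst ℂ ℂ ℂ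
    + (modeZ δ (lam n) (-s) : ℂ) • LinearMap.snd ℂ ℂ ℂ) ∘ₗ LinearMap.proj n

theorem observation_apply (x : ι → ℂ × ℂ) (i : κ) (s : ℝ) : observation δ lam C i s x =
    ∑ n, C n i * (modeP δ (lam n) (-s) * (x n).1 + modeZ δ (lam n) (-s) * (x n).2) := by
  simp only [observation, LinearMap.sum_apply, LinearMap.smul_apply, LinearMap.comp_apply,
    LinearMap.add_apply, LinearMap.proj_apply, LinearMap.fst_apply, LinearMap.snd_apply,
    smul_eq_mul]

theorem hasDerivAt_observation (x : ι → ℂ × ℂ) (i : κ) (s : ℝ) :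
    HasDerivAt (fun s => observation δ lam C i s x)
      (-observation δ lam C i s (adjointGen δ lam x)) s := by
  simp only [observation_apply, adjointGen_apply, ← Finset.sum_neg_distrib]
  refine HasDerivAt.fun_sum fun n _ => ?_
  have hP := ((hasDerivAt_modeP δ (lam n) (-s)).scomp s (hasDerivAt_neg s)).ofReal_comp
  have hZ := ((hasDerivAt_modeZ δ (lam n) (-s)).scomp s (hasDerivAt_neg s)).ofReal_comp
  refine (((hP.mul_const (x n).1).add (hZ.mul_const (x n).2)).const_mul (C n i)).congr_deriv ?_
  simp only [smul_eq_mul, modeY]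
  push_cast
  ring

/-- The states of the dual system whose outputs vanish up to the time `T`. -/
def unobservable (δ : ℝ) (lam : ι → ℝ) (C : Matrix ι κ ℂ) (T : ℝ) : Submodule ℂ (ι → ℂ × ℂ) :=
  ⨅ i, ⨅ s ∈ Ico 0 T, LinearMap.ker (observation δ lam C i s)

theorem mem_unobservable {x : ι → ℂ × ℂ} : x ∈ unobservable δ lam C T ↔
    ∀ i, ∀ s ∈ Ico 0 T, observation δ lam C i s x = 0 := by
  simp only [unobservable, Submodule.mem_iInf, LinearMap.mem_ker]

theorem adjointGen_mem_unobservable {x : ι → ℂ × ℂ} (hx : x ∈ unobservable δ lam C T) :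
    adjointGen δ lam x ∈ unobservable δ lam C T := by
  rw [mem_unobservable] at hx ⊢
  intro i s hs
  have hconst : HasDerivWithinAt (fun s => observation δ lam C i s x) 0 (Ico 0 T) s :=
    (hasDerivWithinAt_const s (Ico 0 T) (0 : ℂ)).congr (fun r hr => hx i r hr) (hx i s hs)
  exact neg_eq_zero.1 ((uniqueDiffOn_Ico 0 T s hs).eq_deriv _
    (hasDerivAt_observation x i s).hasDerivWithinAt hconst)

/-- On a nontrivial invariant subspace the adjoint generator has an eigenvector; all the modes in it
share one eigenvalue, and its output at the time `0` is a relation between their rows of `C`. -/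
theorem HautusCondition.unobservable_eq_bot (hC : HautusCondition lam C) (hδ : 1 + δ ≠ 0)
    (hT : 0 < T) : unobservable δ lam C T = ⊥ := by
  by_contra hne
  have : Nontrivial (unobservable δ lam C T) := (Submodule.nontrivial_iff_ne_bot).2 hne
  obtain ⟨ν, hν⟩ := Module.End.exists_eigenvalue
    ((adjointGen δ lam).restrict fun x (hx : x ∈ unobservable δ lam C T) =>
      adjointGen_mem_unobservable hx)
  obtain ⟨⟨x, hxV⟩, hx⟩ := hν.exists_hasEigenvector
  have hxν : adjointGen δ lam x = ν • x := congrArg Subtype.val hx.apply_eq_smul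
  have hfst : (fun n => (x n).1) = 0 := by
    by_contra hne
    obtain ⟨m, hm⟩ := Function.ne_iff.1 hne
    refine hne (hC.eq_zero (l := lam m) (fun n hn => ?_) fun i => ?_)
    · exact (isCharRoot_neg_of_adjointGen_eq_smul hxν hn).eigenvalue_unique hδ
        (isCharRoot_neg_of_adjointGen_eq_smul hxν hm)
    · simpa [observation_apply, mul_comm] using mem_unobservable.1 hxV i 0 ⟨le_rfl, hT⟩
  refine hx.2 (Subtype.ext (funext fun n => Prod.ext (congrFun hfst n) ?_))
  have hx₁ : (1 - lam n) * (x n).1 + (x n).2 = ν * (x n).1 := congrArg Prod.fst (congrFun hxν n)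
  rwa [show (x n).1 = 0 from congrFun hfst n, mul_zero, mul_zero, zero_add] at hx₁

end Hautus

theorem HautusCondition.exists_nullControl {ι κ : Type*} [Finite ι] [Fintype κ] {δ T : ℝ}
    {lam : ι → ℝ} {C : Matrix ι κ ℂ} (hC : HautusCondition lam C)
    (hδ : 1 + δ ≠ 0) (hT : 0 < T) :
    ∃ R : (ι → ℂ) →ₗ[ℂ] vanishingControls κ T, ∀ c n,
      (∫ s in (0 : ℝ)..T, (modeP δ (lam n) (-s) : ℂ) * ∑ i, C n i * (R c).1 i s = -c n) ∧
        ∫ s in (0 : ℝ)..T, (modeZ δ (lam n) (-s) : ℂ) * ∑ i, C n i * (R c).1 i s = 0 := by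
  have := Fintype.ofFinite ι
  set θ : ι ⊕ ι → κ → ℝ → ℂ := Sum.elim (fun n i s => modeP δ (lam n) (-s) * C n i)
    (fun n i s => modeZ δ (lam n) (-s) * C n i) with hθdef
  have hθ : ∀ k i, ContDiff ℝ 2 (θ k i) := by
    rintro (n | n) i
    · exact (Complex.ofRealCLM.contDiff.comp ((contDiff_modeP _ _).comp contDiff_neg)).mul
        contDiff_const
    · exact (Complex.ofRealCLM.contDiff.comp ((contDiff_modeZ _ _).comp contDiff_neg)).mul
        contDiff_const
  have hindep : ∀ a : ι ⊕ ι → ℂ, (∀ i, ∀ s ∈ Ico 0 T, ∑ k, a k * θ k i s = 0) → a = 0 := by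
    intro a ha
    have hx : (fun n => (a (Sum.inl n), a (Sum.inr n))) ∈ unobservable δ lam C T :=
      mem_unobservable.2 fun i s hs => by
        rw [observation_apply, ← ha i s hs, Fintype.sum_sum_type, ← Finset.sum_add_distrib]
        refine Finset.sum_congr rfl fun n _ => ?_
        simp only [hθdef, Sum.elim_inl, Sum.elim_inr]
        ring
    rw [hC.unobservable_eq_bot hδ hT, Submodule.mem_bot] at hx
    exact funext (Sum.rec (fun n => congrArg Prod.fst (congrFun hx n))
      fun n => congrArg Prod.snd (congrFun hx n))
  obtain ⟨S, hS⟩ := LinearMap.exists_rightInverse_of_surjective _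
    (LinearMap.range_eq_top.2 (moments_surjective hT hθ hindep))
  have hmom : ∀ w k, ∫ s in (0 : ℝ)..T, ∑ i, θ k i s * (S w).1 i s = w k := fun w k =>
    congrFun (LinearMap.congr_fun hS w) k
  refine ⟨S ∘ₗ LinearMap.pi (Sum.elim (fun n => -LinearMap.proj n) fun _ => 0),
    fun c n => ⟨?_, ?_⟩⟩
  · simp only [Finset.mul_sum, ← mul_assoc]
    exact hmom _ (Sum.inl n)
  · simp only [Finset.mul_sum, ← mul_assoc]
    exact hmom _ (Sum.inr n)

/-! ### The rank conditions -/

section RankConditions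

theorem isJordanWithDiag_diagonal {ι : Type*} [Finite ι] [DecidableEq ι] (d : ι → ℂ) :
    IsJordanWithDiag d (Matrix.diagonal d) := by
  obtain ⟨n, ⟨e⟩⟩ := Finite.exists_equiv_fin ι
  refine ⟨Matrix.diagonal_apply_eq d, n, e, fun i j hij _ => ?_, fun i j hij => ?_⟩
  · exact Matrix.diagonal_apply_ne d fun h => hij (e.symm.injective h)
  · refine Or.inl (Matrix.diagonal_apply_ne d fun h => ?_)
    rw [e.symm.injective h] at hij
    exact Nat.succ_ne_self _ hij

theorem IsJordanMatrix.lt_of_apply_ne_zero {n : ℕ} {J : Matrix (Fin n) (Fin n) ℂ}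
    (hJ : IsJordanMatrix J) {i j : Fin n} (hij : i ≠ j) (hne : J i j ≠ 0) :
    i < j ∧ J i i = J j j := by
  have hsucc : (i : ℕ) + 1 = j := of_not_not fun h => hne (hJ.1 i j hij h)
  exact ⟨Fin.lt_def.2 (by omega), ((hJ.2 i j hsucc).resolve_left hne).2⟩

variable {lam : ℕ → ℝ} {δ : ℝ} {N M : ℕ}

theorem isCharRoot_neg_eigList (k : Fin N ⊕ Fin N) :
    IsCharRoot δ (lam (Sum.elim id id k : Fin N)) (-eigList lam δ N k) := by
  rcases k with j | j
  · simpa only [eigList, Sum.elim_inl, id, neg_neg] using isCharRoot_muPlus δ (lam j)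
  · simpa only [eigList, Sum.elim_inr, id, neg_neg] using isCharRoot_muMinus δ (lam j)

section

variable (R : Matrix (Fin N ⊕ Fin N) (Fin N ⊕ Fin N) ℂ) (k : Fin N ⊕ Fin N) (n : Fin N)

theorem mul_matP_inl : (R * matP lam δ N) k (Sum.inl n) =
    -(R k (Sum.inr n) * (lam n * (1 + δ))) := by
  simp [Matrix.mul_apply, matP, Fintype.sum_sum_type, Matrix.fromBlocks, Matrix.diagonal_apply]

theorem mul_matP_inr : (R * matP lam δ N) k (Sum.inr n) =
    R k (Sum.inl n) - R k (Sum.inr n) * (lam n + δ) := by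
  simp only [Matrix.mul_apply, matP, Fintype.sum_sum_type, Matrix.fromBlocks_apply₁₂,
    Matrix.fromBlocks_apply₂₂, Matrix.one_apply, Matrix.neg_apply, Matrix.diagonal_apply, mul_ite,
    mul_one, mul_zero, mul_neg, Finset.sum_neg_distrib, Finset.sum_ite_eq', Finset.mem_univ,
    if_true, Complex.ofReal_add, sub_eq_add_neg]

end

/-- The rows of `R` are chains of generalized left eigenvectors of `P`. Along the chains, which are
followed downwards, the diagonal of `J` stays the same and hence so does the group. -/
theorem apply_eq_zero_of_mul_matP_eq (hδ : 1 + δ ≠ 0)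
    {R J : Matrix (Fin N ⊕ Fin N) (Fin N ⊕ Fin N) ℂ} (hRJ : R * matP lam δ N = J * R)
    (hJ : IsJordanWithDiag (eigList lam δ N) J) (k : Fin N ⊕ Fin N) (n : Fin N)
    (hn : lam n ≠ lam (Sum.elim id id k : Fin N)) : R k (Sum.inl n) = 0 ∧ R k (Sum.inr n) = 0 := by
  obtain ⟨hdiag, m, e, hJe⟩ := hJ
  induction k using (InvImage.wf e (wellFounded_gt (α := Fin m))).induction with
  | _ k ih =>
    have hchain : ∀ k', k' ≠ k → J k k' ≠ 0 → R k' (Sum.inl n) = 0 ∧ R k' (Sum.inr n) = 0 := by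
      intro k' hk' hne
      obtain ⟨hlt, heq⟩ := hJe.lt_of_apply_ne_zero (i := e k) (j := e k')
        (fun h => hk' (e.injective h).symm) (by simpa using hne)
      have hμ : eigList lam δ N k = eigList lam δ N k' := by
        simpa [hdiag] using heq
      refine ih k' hlt fun h => hn (h.trans ?_)
      have hroot := isCharRoot_neg_eigList (lam := lam) (δ := δ) k
      rw [hμ] at hroot
      exact (isCharRoot_neg_eigList k').eigenvalue_unique hδ hroot
    have hinl : -(R k (Sum.inr n) * (lam n * (1 + δ))) = eigList lam δ N k * R k (Sum.inl n) := by
      rw [← mul_matP_inl, hRJ, Matrix.mul_apply, ← hdiag]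
      exact Fintype.sum_eq_single k fun k' hk' =>
        mul_eq_zero.2 (or_iff_not_imp_left.2 fun hne => (hchain k' hk' hne).1)
    have hinr : R k (Sum.inl n) - R k (Sum.inr n) * (lam n + δ)
        = eigList lam δ N k * R k (Sum.inr n) := by
      rw [← mul_matP_inr, hRJ, Matrix.mul_apply, ← hdiag]
      exact Fintype.sum_eq_single k fun k' hk' =>
        mul_eq_zero.2 (or_iff_not_imp_left.2 fun hne => (hchain k' hk' hne).2)
    have hzero : R k (Sum.inr n) = 0 := by
      refine of_not_not fun hne => hn (IsCharRoot.eigenvalue_unique hδ (μ := -eigList lam δ N k) ?_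
        (isCharRoot_neg_eigList k))
      rw [IsCharRoot]
      refine (mul_eq_zero.1 ?_).resolve_left hne
      linear_combination -hinl - eigList lam δ N k * hinr
    refine ⟨?_, hzero⟩
    rwa [hzero, zero_mul, sub_zero, mul_zero] at hinr

theorem linearIndependent_row_of_card_le_rank {ι κ 𝕜 : Type*} [Field 𝕜] [Fintype ι] [Fintype κ]
    {C : Matrix ι κ 𝕜} (h : Fintype.card ι ≤ C.rank) : LinearIndependent 𝕜 C.row := by
  rwa [linearIndependent_iff_card_le_finrank_span, Set.finrank, ← Matrix.rank_eq_finrank_span_row]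

open scoped ComplexOrder in
theorem BlockRank.hautusCondition {R : Matrix (Fin N ⊕ Fin N) (Fin N ⊕ Fin N) ℂ}
    {C : Matrix (Fin N) (Fin M) ℂ}
    (hR : ∀ j n : Fin N, lam n ≠ lam j → R (Sum.inl j) (Sum.inr n) = 0)
    (hrank : BlockRank lam (R * (Matrix.fromRows 0 C : Matrix (Fin N ⊕ Fin N) (Fin M) ℂ))) :
    HautusCondition (fun n : Fin N => lam n) C := by
  intro l
  rcases {n : Fin N | lam n = l}.eq_empty_or_nonempty with hempty | ⟨j, rfl⟩
  · rw [hempty]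
    exact linearIndepOn_empty _ _
  let R' : Matrix {i : Fin N // lam i = lam j} {i : Fin N // lam i = lam j} ℂ :=
    R.submatrix (fun g => Sum.inl g.1) fun g => Sum.inr g.1
  let C' : Matrix {i : Fin N // lam i = lam j} (Fin M) ℂ := C.submatrix Subtype.val id
  have hprod : (R * (Matrix.fromRows 0 C : Matrix (Fin N ⊕ Fin N) (Fin M) ℂ)).submatrix
      (fun g : {i : Fin N // lam i = lam j} => Sum.inl g.1) id = R' * C' := by
    ext g i
    simp only [Matrix.submatrix_apply, Matrix.mul_apply, Fintype.sum_sum_type, id,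
      Matrix.fromRows_apply_inl, Matrix.fromRows_apply_inr, Matrix.zero_apply, mul_zero,
      Finset.sum_const_zero, zero_add]
    symm
    refine Fintype.sum_of_injective Subtype.val Subtype.val_injective _ _ (fun n hn => ?_)
      fun _ => rfl
    rw [hR g.1 n fun h => hn ⟨⟨n, h.trans g.2⟩, rfl⟩, zero_mul]
  have hcard := (hrank j).1
  rw [← Matrix.conjTranspose_submatrix, Matrix.rank_conjTranspose, hprod] at hcard
  exact linearIndependent_row_of_card_le_rank (C := C')
    (hcard.symm.le.trans (Matrix.rank_mul_le_right _ _))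

variable {H : Type*} [NormedAddCommGroup H] [InnerProductSpace ℝ H] {B : H →L[ℝ] H} {φ : ℕ → H}
  {Φ : Fin M → Complexification H}

/-- The matrix `C` with the entries `(B Φᵢ, φⱼ)`, the lower half of `matQ`. -/
def controlMatrix {ι κ : Type*} (B : H →L[ℝ] H) (φ : ι → H) (Φ : κ → Complexification H) :
    Matrix ι κ ℂ :=
  Matrix.of fun j i => inner ℂ (ofReal (φ j)) (mapL B (Φ i))

theorem SemisimpleRankCondition.jordanRankCondition
    (h : SemisimpleRankCondition B φ lam δ N Φ) : JordanRankCondition B φ lam δ N Φ :=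
  let ⟨R, hR, hP, hrank⟩ := h
  ⟨R, _, hR, isJordanWithDiag_diagonal _, hP, hrank⟩

theorem JordanRankCondition.hautusCondition (hδ : 1 + δ ≠ 0)
    (h : JordanRankCondition B φ lam δ N Φ) :
    HautusCondition (fun n : Fin N => lam n) (controlMatrix B (fun n : Fin N => φ n) Φ) := by
  obtain ⟨R, J, hR, hJ, hP, hrank⟩ := h
  have hRJ : R * matP lam δ N = J * R := by
    rw [hP, mul_assoc, Matrix.mul_nonsing_inv_cancel_left _ _
      ((Matrix.isUnit_iff_isUnit_det R).1 hR)]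
  exact hrank.hautusCondition fun j n hn =>
    (apply_eq_zero_of_mul_matP_eq hδ hRJ hJ (Sum.inl j) n hn).2

end RankConditions

/-! ### Diagonal operators in a Hilbert basis -/

section Diagonal

variable {ι 𝕜 E : Type*} [RCLike 𝕜] [NormedAddCommGroup E] [InnerProductSpace 𝕜 E]

theorem hilbertBasis_ext (b : HilbertBasis ι 𝕜 E) {x y : E}
    (h : ∀ n, inner 𝕜 (b n) x = inner 𝕜 (b n) y) : x = y :=
  b.repr.injective <| lp.ext <| funext fun n => by simpa only [b.repr_apply_apply] using h n

theorem exists_clm_inner_apply_eq_mul (b : HilbertBasis ι 𝕜 E) {d : ι → 𝕜} {K : ℝ} (hK : 0 ≤ K)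
    (hd : ∀ n, ‖d n‖ ≤ K) :
    ∃ S : E →L[𝕜] E, (∀ x, ‖S x‖ ≤ K * ‖x‖) ∧
      ∀ x n, inner 𝕜 (b n) (S x) = d n * inner 𝕜 (b n) x := by
  have hle : ∀ n, ‖d n • ContinuousLinearMap.id 𝕜 𝕜‖ ≤ K := fun n => by
    simpa only [norm_smul, ContinuousLinearMap.norm_id, mul_one] using hd n
  let D := lp.mapCLM 2 (fun n => d n • ContinuousLinearMap.id 𝕜 𝕜) hK hle
  refine ⟨b.repr.symm.toContinuousLinearEquiv.toContinuousLinearMap ∘L D ∘L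
    b.repr.toContinuousLinearEquiv.toContinuousLinearMap, fun x => ?_, fun x n => ?_⟩
  · have hD := D.le_of_opNorm_le (lp.norm_mapCLM_le 2 _ hK hle) (b.repr x)
    rw [b.repr.norm_map] at hD
    exact (b.repr.symm.norm_map _).trans_le hD
  · rw [← b.repr_apply_apply, ← b.repr_apply_apply]
    simp [D]

theorem continuous_clm_apply_of_dense_span {X F : Type*} [TopologicalSpace X]
    [NormedAddCommGroup F] [NormedSpace 𝕜 F] {S : X → E →L[𝕜] F} {r : X → ℝ} {s : Set E}
    (hr : Continuous r) (hSr : ∀ t x, ‖S t x‖ ≤ r t * ‖x‖)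
    (hs : (Submodule.span 𝕜 s).topologicalClosure = ⊤) (hSs : ∀ x ∈ s, Continuous fun t => S t x)
    (x : E) : Continuous fun t => S t x := by
  have hspan : ∀ y ∈ Submodule.span 𝕜 s, Continuous fun t => S t y := fun y hy => by
    induction hy using Submodule.span_induction with
    | mem y hy => exact hSs y hy
    | zero => simpa only [map_zero] using continuous_const
    | add y z _ _ hy hz => exact (hy.add hz).congr fun t => (map_add (S t) y z).symm
    | smul c y _ hy => exact (hy.const_smul c).congr fun t => (map_smul (S t) c y).symm
  refine continuous_iff_continuousAt.2 fun t₀ =>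
    continuousAt_of_locally_uniform_approx_of_continuousAt fun u hu => ?_
  obtain ⟨ε, hε, hεu⟩ := Metric.mem_uniformity_dist.1 hu
  have hK : 0 < |r t₀| + 1 := by positivity
  obtain ⟨y, hy, hxy⟩ := Metric.mem_closure_iff.1
    ((Submodule.dense_iff_topologicalClosure_eq_top.2 hs) x) (ε / (|r t₀| + 1)) (div_pos hε hK)
  refine ⟨{t | r t < |r t₀| + 1}, (hr.tendsto t₀).eventually_lt_const ?_, fun t => S t y,
    (hspan y hy).continuousAt, fun t ht => hεu ?_⟩
  · linarith [le_abs_self (r t₀)]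
  rw [dist_eq_norm] at hxy
  calc dist (S t x) (S t y) = ‖S t (x - y)‖ := by rw [dist_eq_norm, map_sub]
    _ ≤ r t * ‖x - y‖ := hSr t _
    _ ≤ (|r t₀| + 1) * ‖x - y‖ := mul_le_mul_of_nonneg_right (le_of_lt ht) (norm_nonneg _)
    _ < (|r t₀| + 1) * (ε / (|r t₀| + 1)) := mul_lt_mul_of_pos_left hxy hK
    _ = ε := mul_div_cancel₀ ε hK.ne'

/-- The operators `S t`, `t ≥ 0`, multiply the `n`-th coordinate in the basis `b` by `m n t`, and
`S` is strongly continuous. The values at negative times are constrained only by continuity. -/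
structure IsDiagonalFamily (b : HilbertBasis ι 𝕜 E) (m : ι → ℝ → ℝ) (S : ℝ → E →L[𝕜] E) :
    Prop where
  inner_apply : ∀ t, 0 ≤ t → ∀ x n, inner 𝕜 (b n) (S t x) = m n t * inner 𝕜 (b n) x
  continuous_apply : ∀ x, Continuous fun t => S t x

theorem exists_isDiagonalFamily (b : HilbertBasis ι 𝕜 E) {m : ι → ℝ → ℝ} {r : ℝ → ℝ}
    (hm : ∀ n, Continuous (m n)) (hr : Continuous r) (hr0 : ∀ t, 0 ≤ t → 0 ≤ r t)
    (hmr : ∀ n t, 0 ≤ t → |m n t| ≤ r t) :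
    ∃ S : ℝ → E →L[𝕜] E, IsDiagonalFamily b m S ∧ ∀ t, 0 ≤ t → ∀ x, ‖S t x‖ ≤ r t * ‖x‖ := by
  have hex := fun t : ℝ => exists_clm_inner_apply_eq_mul b (d := fun n => (m n (max t 0) : 𝕜))
    (hr0 _ (le_max_right t 0)) fun n => by
      simpa only [RCLike.norm_ofReal] using hmr n _ (le_max_right t 0)
  choose S hSr hS using hex
  refine ⟨S, ⟨fun t ht x n => by rw [hS, max_eq_left ht], fun x => ?_⟩,
    fun t ht x => by simpa only [max_eq_left ht] using hSr t x⟩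
  refine continuous_clm_apply_of_dense_span (hr.comp (continuous_id.max continuous_const)) hSr
    b.dense_span (forall_mem_range.2 fun n => ?_) x
  have hSb : ∀ t, S t (b n) = (m n (max t 0) : 𝕜) • b n := fun t => hilbertBasis_ext b fun k => by
    rw [hS, inner_smul_right]
    rcases eq_or_ne k n with rfl | hkn
    · rfl
    · rw [b.orthonormal.2 hkn, mul_zero, mul_zero]
  simp only [hSb]
  exact (RCLike.continuous_ofReal.comp
    ((hm n).comp (continuous_id.max continuous_const))).smul continuous_const

/-- `A` is, with its maximal domain, multiplication of the `n`-th coordinate in the basis `b` by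
`lam n`. -/
def IsDiagonalizedBy (A : E →ₗ.[𝕜] E) (b : HilbertBasis ι 𝕜 E) (lam : ι → ℝ) : Prop :=
  ∀ x w, (x, w) ∈ A.graph ↔ ∀ n, inner 𝕜 (b n) w = lam n * inner 𝕜 (b n) x

theorem inner_eq_inner_of_inner_eq_mul (b : HilbertBasis ι 𝕜 E) {lam : ι → ℝ} {x w x' w' : E}
    (h : ∀ n, inner 𝕜 (b n) w = lam n * inner 𝕜 (b n) x)
    (h' : ∀ n, inner 𝕜 (b n) w' = lam n * inner 𝕜 (b n) x') : inner 𝕜 w x' = inner 𝕜 x w' := by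
  rw [← b.tsum_inner_mul_inner, ← b.tsum_inner_mul_inner]
  refine tsum_congr fun n => ?_
  rw [h', ← inner_conj_symm w, h, map_mul, RCLike.conj_ofReal, inner_conj_symm]
  ring

theorem isDiagonalizedBy_of_isSelfAdjoint [CompleteSpace E] {A : E →ₗ.[𝕜] E}
    (hA : IsSelfAdjoint A) {b : HilbertBasis ι 𝕜 E} {lam : ι → ℝ}
    (hb : ∀ n, (b n, (lam n : 𝕜) • b n) ∈ A.graph) : IsDiagonalizedBy A b lam := by
  have hgraph : ∀ x w, (x, w) ∈ A.graph ↔ ∀ x' w', (x', w') ∈ A.graph →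
      inner 𝕜 w' x = inner 𝕜 x' w := fun x w => by
    conv_lhs => rw [← LinearPMap.isSelfAdjoint_def.1 hA]
    simp only [LinearPMap.adjoint_graph_eq_graph_adjoint hA.dense_domain,
      Submodule.mem_adjoint_iff, sub_eq_zero]
  have hcoord : ∀ x w, (x, w) ∈ A.graph → ∀ n, inner 𝕜 (b n) w = lam n * inner 𝕜 (b n) x :=
    fun x w hxw n => by
      rw [← (hgraph x w).1 hxw _ _ (hb n), inner_smul_left, RCLike.conj_ofReal]
  exact fun x w => ⟨hcoord x w, fun h => (hgraph x w).2 fun x' w' h' =>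
    inner_eq_inner_of_inner_eq_mul b (hcoord x' w' h') h⟩

end Diagonal

end PIDE

namespace Complexification

variable {H : Type*} [NormedAddCommGroup H] [InnerProductSpace ℝ H]

theorem inner_ofReal_left (x : H) (z : Complexification H) :
    inner ℂ (ofReal x) z = ⟨inner ℝ x z.re, inner ℝ x z.im⟩ := by
  change (⟨inner ℝ x z.re + inner ℝ (0 : H) z.im, inner ℝ x z.im - inner ℝ (0 : H) z.re⟩ : ℂ) = _
  simp

theorem ofReal_mem_domain_mapPMap {A : H →ₗ.[ℝ] H} {x : H} (hx : x ∈ A.domain) :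
    ofReal x ∈ (mapPMap A).domain :=
  ⟨hx, A.domain.zero_mem⟩

theorem mem_graph_mapPMap_iff {A : H →ₗ.[ℝ] H} {z w : Complexification H} :
    (z, w) ∈ (mapPMap A).graph ↔ (z.re, w.re) ∈ A.graph ∧ (z.im, w.im) ∈ A.graph := by
  simp only [LinearPMap.mem_graph_iff]
  constructor
  · rintro ⟨x, rfl, rfl⟩
    exact ⟨⟨⟨_, x.2.1⟩, rfl, rfl⟩, ⟨⟨_, x.2.2⟩, rfl, rfl⟩⟩
  · rintro ⟨⟨x, hx, hAx⟩, ⟨y, hy, hAy⟩⟩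
    refine ⟨⟨z, hx ▸ x.2, hy ▸ y.2⟩, rfl, ext' ?_ ?_⟩
    · exact (congrArg A (Subtype.ext hx.symm)).trans hAx
    · exact (congrArg A (Subtype.ext hy.symm)).trans hAy

theorem orthonormal_ofReal {ι : Type*} {φ : ι → H} (hφ : Orthonormal ℝ φ) :
    Orthonormal ℂ fun n => ofReal (φ n) := by
  classical
  refine orthonormal_iff_ite.2 fun i j => ?_
  rw [inner_ofReal_left, ofReal, re_mk, im_mk, inner_zero_right, orthonormal_iff_ite.1 hφ]
  split_ifs <;> rfl

theorem orthogonal_span_ofReal_eq_bot {ι : Type*} (φ : HilbertBasis ι ℝ H) :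
    (Submodule.span ℂ (Set.range fun n => ofReal (φ n)))ᗮ = ⊥ := by
  refine (Submodule.eq_bot_iff _).2 fun z hz => ?_
  have hz0 : ∀ n, (⟨inner ℝ (φ n) z.re, inner ℝ (φ n) z.im⟩ : ℂ) = 0 := fun n => by
    rw [← inner_ofReal_left]
    exact (Submodule.mem_orthogonal _ _).1 hz _ (Submodule.subset_span ⟨n, rfl⟩)
  refine ext' (PIDE.hilbertBasis_ext φ fun n => ?_) (PIDE.hilbertBasis_ext φ fun n => ?_)
  · simpa only [re_zero, inner_zero_right, Complex.zero_re] using congrArg Complex.re (hz0 n)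
  · simpa only [im_zero, inner_zero_right, Complex.zero_im] using congrArg Complex.im (hz0 n)

/-- A Hilbert basis of a real space, as a basis of the complexification. -/
protected def hilbertBasis [CompleteSpace H] {ι : Type*} (φ : HilbertBasis ι ℝ H) :
    HilbertBasis ι ℂ (Complexification H) :=
  HilbertBasis.mkOfOrthogonalEqBot (orthonormal_ofReal φ.orthonormal)
    (orthogonal_span_ofReal_eq_bot φ)

theorem hilbertBasis_apply [CompleteSpace H] {ι : Type*} (φ : HilbertBasis ι ℝ H) (n : ι) :
    Complexification.hilbertBasis φ n = ofReal (φ n) :=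
  congrFun (HilbertBasis.coe_mkOfOrthogonalEqBot _ _) n

end Complexification

namespace PIDE

open Set Filter MeasureTheory Complexification
open scoped Topology

theorem IsDiagonalizedBy.mapPMap {ι H : Type*} [NormedAddCommGroup H] [InnerProductSpace ℝ H]
    [CompleteSpace H] {A : H →ₗ.[ℝ] H} {φ : HilbertBasis ι ℝ H} {lam : ι → ℝ}
    (hA : IsDiagonalizedBy A φ lam) :
    IsDiagonalizedBy (mapPMap A) (Complexification.hilbertBasis φ) lam := fun z w => by
  simp only [mem_graph_mapPMap_iff, hA _ _, ← forall_and, hilbertBasis_apply, inner_ofReal_left]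
  refine forall_congr' fun n => ?_
  simp [Complex.ext_iff]

/-! ### Uniqueness of weak solutions -/

theorem hasDerivAt_integral_kernel {V : Type*} [NormedAddCommGroup V] [NormedSpace ℂ V]
    [CompleteSpace V] (δ : ℝ) {w : ℝ → V} (hw : Continuous w) (t : ℝ) :
    HasDerivAt (fun t => ∫ s in (0 : ℝ)..t, (kernel δ (t - s) : ℂ) • w s)
      (w t - (δ : ℂ) • ∫ s in (0 : ℝ)..t, (kernel δ (t - s) : ℂ) • w s) t := by
  refine (hasDerivAt_integral_conv (hasDerivAt_ofReal_kernel δ) (by fun_prop) hw t).congr_deriv ?_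
  simp only [kernel_zero, Complex.ofReal_one, one_smul, neg_smul, mul_smul,
    intervalIntegral.integral_neg, intervalIntegral.integral_smul, ← sub_eq_add_neg]

/-- With the memory `z` of `w`, the pair `(w, z)` solves a linear ordinary differential equation. -/
theorem eq_zero_of_hasDerivWithinAt_memory {V : Type*} [NormedAddCommGroup V] [NormedSpace ℂ V]
    [CompleteSpace V] {δ : ℝ} {l : ℂ} {w : ℝ → V} (hw : Continuous w) (hw0 : w 0 = 0)
    (hwd : ∀ t, 0 ≤ t → HasDerivWithinAt w
      (-(l • (w t + ∫ s in (0 : ℝ)..t, (kernel δ (t - s) : ℂ) • w s))) (Ici t) t)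
    {t : ℝ} (ht : 0 ≤ t) : w t = 0 := by
  set z : ℝ → V := fun t => ∫ s in (0 : ℝ)..t, (kernel δ (t - s) : ℂ) • w s with hz
  have hzd : ∀ t, HasDerivAt z (w t - (δ : ℂ) • z t) t := hasDerivAt_integral_kernel δ hw
  have hzc : Continuous z := continuous_iff_continuousAt.2 fun t => (hzd t).continuousAt
  let L : V × V →L[ℂ] V × V :=
    (-(l • (ContinuousLinearMap.fst ℂ V V + ContinuousLinearMap.snd ℂ V V))).prod
      (ContinuousLinearMap.fst ℂ V V - (δ : ℂ) • ContinuousLinearMap.snd ℂ V V)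
  exact congrArg Prod.fst <| eq_zero_of_abs_deriv_le_mul_abs_self_of_eq_zero_right
    (f := fun t => (w t, z t)) (f' := fun t => L (w t, z t)) (hw.prodMk hzc).continuousOn
    (fun t ht => (hwd t ht.1).prodMk (hzd t).hasDerivWithinAt) (by simp [hz, hw0])
    (fun t _ => L.le_opNorm _) t ⟨ht, le_rfl⟩

section Uniqueness

variable {ι H : Type*} [NormedAddCommGroup H] [InnerProductSpace ℝ H] {A : H →ₗ.[ℝ] H} {δ : ℝ}
  {F : ℝ → Complexification H} {y₀ : Complexification H} {y : ℝ → Complexification H}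
  {b : HilbertBasis ι ℂ (Complexification H)} {lam : ι → ℝ}

theorem IsDiagonalizedBy.basis_mem_graph {𝕜 E : Type*} [RCLike 𝕜] [NormedAddCommGroup E]
    [InnerProductSpace 𝕜 E] {A : E →ₗ.[𝕜] E} {b : HilbertBasis ι 𝕜 E}
    (hA : IsDiagonalizedBy A b lam) (n : ι) : (b n, (lam n : 𝕜) • b n) ∈ A.graph := by
  refine (hA _ _).2 fun k => ?_
  rw [inner_smul_right]
  rcases eq_or_ne k n with rfl | hkn
  · rfl
  · rw [b.orthonormal.2 hkn, mul_zero, mul_zero]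

theorem IsWeakSolution.continuous_comp_max (hy : IsWeakSolution A δ F y₀ y) :
    Continuous fun t => y (max t 0) :=
  hy.continuousOn.comp_continuous (continuous_id.max continuous_const) fun t =>
    mem_Ici.2 (le_max_right t 0)

theorem IsWeakSolution.hasDerivWithinAt_inner (hA : IsDiagonalizedBy (mapPMap A) b lam)
    (hy : IsWeakSolution A δ F y₀ y) (n : ι) {t : ℝ} (ht : 0 ≤ t) :
    HasDerivWithinAt (fun t => inner ℂ (b n) (y (max t 0)))
      (inner ℂ (b n) (F t) - lam n * (inner ℂ (b n) (y (max t 0))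
        + ∫ s in (0 : ℝ)..t, (kernel δ (t - s) : ℂ) * inner ℂ (b n) (y (max s 0)))) (Ici t) t := by
  obtain ⟨ψ, hψ, hAψ⟩ := (LinearPMap.mem_graph_iff _).1 (hA.basis_mem_graph n)
  have hmem : ∫ s in (0 : ℝ)..t, (kernel δ (t - s) : ℂ) * (lam n * inner ℂ (b n) (y s))
      = lam n * ∫ s in (0 : ℝ)..t, (kernel δ (t - s) : ℂ) * inner ℂ (b n) (y (max s 0)) := by
    rw [← intervalIntegral.integral_const_mul]
    refine intervalIntegral.integral_congr fun s hs => ?_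
    rw [uIcc_of_le ht] at hs
    simp only [max_eq_left hs.1]
    ring
  have hweak := hy.weak_eq ψ t ht
  simp only [hψ, hAψ, inner_smul_left, RCLike.conj_ofReal] at hweak
  refine ((hweak.congr (fun s hs => ?_) ?_).mono (Ici_subset_Ici.2 ht)).congr_deriv ?_
  · rw [max_eq_left hs]
  · rw [max_eq_left ht]
  · rw [max_eq_left ht, mul_add, ← hmem, sub_add_eq_sub_sub]
    rfl

theorem IsWeakSolution.eqOn (hA : IsDiagonalizedBy (mapPMap A) b lam)
    (hy : IsWeakSolution A δ F y₀ y) {z : ℝ → Complexification H}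
    (hz : IsWeakSolution A δ F y₀ z) : EqOn z y (Ici 0) := by
  intro t ht
  refine hilbertBasis_ext b fun n => sub_eq_zero.1 ?_
  have hyc : Continuous fun t => inner ℂ (b n) (y (max t 0)) :=
    continuous_const.inner hy.continuous_comp_max
  have hzc : Continuous fun t => inner ℂ (b n) (z (max t 0)) :=
    continuous_const.inner hz.continuous_comp_max
  have hzero := eq_zero_of_hasDerivWithinAt_memory (δ := δ) (l := lam n)
    (w := fun t => inner ℂ (b n) (z (max t 0)) - inner ℂ (b n) (y (max t 0))) (hzc.sub hyc)
    (by simp only [max_self, hy.initial, hz.initial, sub_self]) (fun t ht => by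
      refine ((hz.hasDerivWithinAt_inner hA n ht).fun_sub
        (hy.hasDerivWithinAt_inner hA n ht)).congr_deriv ?_
      simp only [smul_eq_mul, mul_sub]
      rw [intervalIntegral.integral_sub (Continuous.intervalIntegrable (by fun_prop) _ _)
        (Continuous.intervalIntegrable (by fun_prop) _ _)]
      ring) (mem_Ici.1 ht)
  simpa only [max_eq_left (mem_Ici.1 ht)] using hzero

end Uniqueness

/-! ### Solutions given by their modes -/

section Integrals

variable {ι E : Type*} [NormedAddCommGroup E] [InnerProductSpace ℂ E] [CompleteSpace E]

theorem inner_intervalIntegral (x : E) {u : ℝ → E} (hu : Continuous u) (a c : ℝ) :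
    inner ℂ x (∫ s in a..c, u s) = ∫ s in a..c, inner ℂ x (u s) :=
  ((innerSL ℂ x).intervalIntegral_comp_comm (hu.intervalIntegrable a c)).symm

theorem inner_integral_conv (x : E) {k : ℝ → ℂ} {u : ℝ → E} (hk : Continuous k)
    (hu : Continuous u) (t : ℝ) :
    inner ℂ x (∫ s in (0 : ℝ)..t, k (t - s) • u s)
      = ∫ s in (0 : ℝ)..t, k (t - s) * inner ℂ x (u s) := by
  rw [inner_intervalIntegral x (by fun_prop)]
  simp only [inner_smul_right]

theorem IsDiagonalizedBy.integral_conv_mem_graph {b : HilbertBasis ι ℂ E} {lam : ι → ℝ}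
    {A : E →ₗ.[ℂ] E} (hA : IsDiagonalizedBy A b lam) {k : ℝ → ℂ}
    {x w : ℝ → E} (hk : Continuous k) (hx : Continuous x) (hw : Continuous w) {t : ℝ} (ht : 0 ≤ t)
    (hxw : ∀ s, 0 ≤ s → (x s, w s) ∈ A.graph) :
    (∫ s in (0 : ℝ)..t, k (t - s) • x s, ∫ s in (0 : ℝ)..t, k (t - s) • w s) ∈ A.graph := by
  refine (hA _ _).2 fun n => ?_
  rw [inner_integral_conv _ hk hx, inner_integral_conv _ hk hw,
    ← intervalIntegral.integral_const_mul]
  refine intervalIntegral.integral_congr fun s hs => ?_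
  rw [uIcc_of_le ht] at hs
  simp only [(hA _ _).1 (hxw s hs.1) n]
  ring

end Integrals

section Modal

variable {ι E : Type*} [NormedAddCommGroup E] [InnerProductSpace ℂ E]
  {b : HilbertBasis ι ℂ E} {lam : ι → ℝ} {A : E →ₗ.[ℂ] E}

/-- For `t ≥ 0` the coordinates of `y` are the modes of the solution with the initial value `y₀`
and the forcing term `F`, and those of `p` are the modes of `y + ∫ β y`. -/
structure IsModalSolution (b : HilbertBasis ι ℂ E) (lam : ι → ℝ) (δ : ℝ) (F : ℝ → E) (y₀ : E)
    (y p : ℝ → E) : Prop where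
  continuous_forcing : Continuous F
  continuous : Continuous y
  continuous_p : Continuous p
  inner_eq : ∀ t, 0 ≤ t → ∀ n, inner ℂ (b n) (y t)
    = response (modeY δ (lam n)) (inner ℂ (b n) y₀) (fun s => inner ℂ (b n) (F s)) t
  inner_p_eq : ∀ t, 0 ≤ t → ∀ n, inner ℂ (b n) (p t)
    = response (modeP δ (lam n)) (inner ℂ (b n) y₀) (fun s => inner ℂ (b n) (F s)) t

namespace IsModalSolution

variable {δ : ℝ} {F : ℝ → E} {y₀ : E} {y p : ℝ → E}

theorem continuous_inner_forcing (h : IsModalSolution b lam δ F y₀ y p) (n : ι) :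
    Continuous fun s => inner ℂ (b n) (F s) :=
  continuous_const.inner h.continuous_forcing

theorem initial (h : IsModalSolution b lam δ F y₀ y p) : y 0 = y₀ :=
  hilbertBasis_ext b fun n => by rw [h.inner_eq 0 le_rfl, response_zero, modeY_zero]; simp

theorem p_mem_graph (hA : IsDiagonalizedBy A b lam) (h : IsModalSolution b lam δ F y₀ y p) {y' : E}
    {t : ℝ} (ht : 0 ≤ t) (hy' : HasDerivWithinAt y y' (Ici 0) t) : (p t, F t - y') ∈ A.graph := by
  refine (hA _ _).2 fun n => ?_
  have hinner : HasDerivWithinAt (fun s => inner ℂ (b n) (y s)) (inner ℂ (b n) y') (Ici 0) t :=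
    ((innerSL ℂ (b n)).restrictScalars ℝ).hasFDerivAt.comp_hasDerivWithinAt t hy'
  have hresp := (hasDerivAt_response_modeY δ (lam n) (inner ℂ (b n) y₀)
    (h.continuous_inner_forcing n) t).hasDerivWithinAt (s := Ici 0)
  rw [inner_sub_right, h.inner_p_eq t ht, (uniqueDiffOn_Ici (0 : ℝ) t ht).eq_deriv _ hinner
    (hresp.congr (fun s hs => h.inner_eq s hs n) (h.inner_eq t ht n)), sub_sub_cancel,
    RCLike.ofReal_eq_complex_ofReal]

variable [CompleteSpace E]

theorem p_eq_add_integral (h : IsModalSolution b lam δ F y₀ y p) {t : ℝ} (ht : 0 ≤ t) :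
    p t = y t + ∫ s in (0 : ℝ)..t, (kernel δ (t - s) : ℂ) • y s := by
  refine hilbertBasis_ext b fun n => ?_
  rw [inner_add_right, inner_integral_conv (k := fun s => (kernel δ s : ℂ)) _ (by fun_prop)
    h.continuous, h.inner_eq t ht, h.inner_p_eq t ht,
    response_modeP _ _ _ (h.continuous_inner_forcing n),
    ← integral_kernel_mul_response_modeY _ _ _ (h.continuous_inner_forcing n)]
  congr 1
  refine intervalIntegral.integral_congr fun s hs => ?_
  rw [uIcc_of_le ht] at hs
  simp only [h.inner_eq s hs.1]

theorem eq_p_sub_integral (h : IsModalSolution b lam δ F y₀ y p) {t : ℝ} (ht : 0 ≤ t) :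
    y t = p t - ∫ s in (0 : ℝ)..t, (kernel (1 + δ) (t - s) : ℂ) • p s := by
  refine hilbertBasis_ext b fun n => ?_
  have hmem : ∫ s in (0 : ℝ)..t, (kernel (1 + δ) (t - s) : ℂ) * inner ℂ (b n) (p s)
      = response (modeZ δ (lam n)) (inner ℂ (b n) y₀) (fun s => inner ℂ (b n) (F s)) t := by
    rw [← integral_kernel_mul_response_modeP _ _ _ (h.continuous_inner_forcing n)]
    refine intervalIntegral.integral_congr fun s hs => ?_
    rw [uIcc_of_le ht] at hs
    simp only [h.inner_p_eq s hs.1]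
  rw [inner_sub_right, inner_integral_conv (k := fun s => (kernel (1 + δ) s : ℂ)) _ (by fun_prop)
    h.continuous_p, hmem, h.inner_eq t ht, h.inner_p_eq t ht,
    response_modeP _ _ _ (h.continuous_inner_forcing n), add_sub_cancel_right]

theorem integral_mem_graph (hA : IsDiagonalizedBy A b lam) (h : IsModalSolution b lam δ F y₀ y p)
    {t : ℝ} (ht : 0 ≤ t) :
    (∫ s in (0 : ℝ)..t, p s, y₀ + (∫ s in (0 : ℝ)..t, F s) - y t) ∈ A.graph := by
  refine (hA _ _).2 fun n => ?_
  have hF := h.continuous_inner_forcing n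
  have hP := continuous_response (c := inner ℂ (b n) y₀) (continuous_modeP δ (lam n)) hF
  have hint := intervalIntegral.integral_eq_sub_of_hasDerivAt (a := 0) (b := t)
    (fun s _ => hasDerivAt_response_modeY δ (lam n) (inner ℂ (b n) y₀) hF s)
    (Continuous.intervalIntegrable (by fun_prop) _ _)
  rw [intervalIntegral.integral_sub (hF.intervalIntegrable _ _)
    (Continuous.intervalIntegrable (by fun_prop) _ _), intervalIntegral.integral_const_mul,
    response_zero, modeY_zero, Complex.ofReal_one, one_mul] at hint
  have hp : ∫ s in (0 : ℝ)..t, inner ℂ (b n) (p s) = ∫ s in (0 : ℝ)..t,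
      response (modeP δ (lam n)) (inner ℂ (b n) y₀) (fun s => inner ℂ (b n) (F s)) s := by
    refine intervalIntegral.integral_congr fun s hs => ?_
    rw [uIcc_of_le ht] at hs
    exact h.inner_p_eq s hs.1 n
  rw [inner_sub_right, inner_add_right, inner_intervalIntegral _ h.continuous_forcing,
    inner_intervalIntegral _ h.continuous_p, h.inner_eq t ht, hp, RCLike.ofReal_eq_complex_ofReal]
  linear_combination hint

end IsModalSolution

end Modal

namespace IsModalSolution

variable {ι H : Type*} [NormedAddCommGroup H] [InnerProductSpace ℝ H] [CompleteSpace H]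
  {A : H →ₗ.[ℝ] H} {b : HilbertBasis ι ℂ (Complexification H)} {lam : ι → ℝ} {δ : ℝ}
  {F : ℝ → Complexification H} {y₀ : Complexification H} {y p : ℝ → Complexification H}

theorem isWeakSolution (hA : IsDiagonalizedBy (mapPMap A) b lam)
    (h : IsModalSolution b lam δ F y₀ y p) : IsWeakSolution A δ F y₀ y := by
  refine ⟨h.continuous.continuousOn, h.initial, fun ψ t ht => ?_⟩
  set χ := mapPMap A ψ
  have hF := h.continuous_forcing
  have hp := h.continuous_p
  have hint : ∀ t, 0 ≤ t → inner ℂ (ψ : Complexification H) (y t)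
      = inner ℂ (ψ : Complexification H) y₀
        + ∫ s in (0 : ℝ)..t, (inner ℂ (ψ : Complexification H) (F s) - inner ℂ χ (p s)) := by
    intro t ht
    have hpair := inner_eq_inner_of_inner_eq_mul b
      ((hA _ _).1 (LinearPMap.mem_graph _ ψ)) ((hA _ _).1 (h.integral_mem_graph hA ht))
    rw [inner_sub_right, inner_add_right, inner_intervalIntegral _ hF,
      inner_intervalIntegral _ hp] at hpair
    rw [intervalIntegral.integral_sub (Continuous.intervalIntegrable (by fun_prop) _ _)
      (Continuous.intervalIntegrable (by fun_prop) _ _), hpair]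
    ring
  have hderiv : HasDerivAt (fun t => inner ℂ (ψ : Complexification H) y₀
      + ∫ s in (0 : ℝ)..t, (inner ℂ (ψ : Complexification H) (F s) - inner ℂ χ (p s)))
      (inner ℂ (ψ : Complexification H) (F t) - inner ℂ χ (p t)) t :=
    (((continuous_const.inner hF).sub
      (continuous_const.inner hp)).integral_hasStrictDerivAt 0 t).hasDerivAt.const_add _
  refine (hderiv.hasDerivWithinAt.congr hint (hint t ht)).congr_deriv ?_
  rw [h.p_eq_add_integral ht, inner_add_right,
    inner_integral_conv (k := fun s => (kernel δ s : ℂ)) _ (by fun_prop) h.continuous,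
    sub_add_eq_sub_sub]

/-- The equation `y = p - ∫ e^{-(1+δ)(t-s)} p` carries the regularity of `p` over to `y`. -/
theorem isClassicalSolution (hA : IsDiagonalizedBy (mapPMap A) b lam)
    (h : IsModalSolution b lam δ F y₀ y p) {y' : ℝ → Complexification H} (hy'c : Continuous y')
    (hy' : ∀ t, 0 ≤ t → HasDerivWithinAt y (y' t) (Ici 0) t) : IsClassicalSolution A δ F y₀ y := by
  have hFc : Continuous fun t => F t - y' t := h.continuous_forcing.sub hy'c
  have hp : ∀ t, 0 ≤ t → (p t, F t - y' t) ∈ (mapPMap A).graph := fun t ht =>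
    h.p_mem_graph hA ht (hy' t ht)
  set z : ℝ → Complexification H := fun t =>
    (F t - y' t) - ∫ s in (0 : ℝ)..t, (kernel (1 + δ) (t - s) : ℂ) • (F s - y' s)
  have hzc : Continuous z := hFc.sub
    (continuous_integral_conv (k := fun s => (kernel (1 + δ) s : ℂ)) (by fun_prop) hFc)
  have hyz : ∀ t, 0 ≤ t → (y t, z t) ∈ (mapPMap A).graph := fun t ht => by
    rw [h.eq_p_sub_integral ht]
    exact (mapPMap A).graph.sub_mem (hp t ht) (hA.integral_conv_mem_graph
      (k := fun s => (kernel (1 + δ) s : ℂ)) (by fun_prop) h.continuous_p hFc ht hp)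
  have hpz : ∀ t, 0 ≤ t →
      F t - y' t = z t + ∫ s in (0 : ℝ)..t, (kernel δ (t - s) : ℂ) • z s := fun t ht =>
    (mapPMap A).mem_graph_snd_inj (hp t ht) ((mapPMap A).graph.add_mem (hyz t ht)
      (hA.integral_conv_mem_graph (k := fun s => (kernel δ s : ℂ)) (by fun_prop) h.continuous hzc
        ht hyz)) (h.p_eq_add_integral ht)
  refine ⟨(contDiffOn_one_iff_derivWithin (uniqueDiffOn_Ici 0)).2
    ⟨fun t ht => (hy' t ht).differentiableWithinAt, hy'c.continuousOn.congr fun t ht =>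
      (hy' t ht).derivWithin (uniqueDiffOn_Ici 0 t ht)⟩,
    h.initial, z, hzc.continuousOn, hyz, fun t ht => (hy' t ht).congr_deriv ?_⟩
  rw [sub_sub, ← hpz t ht, sub_sub_cancel]

end IsModalSolution

/-! ### Variation of constants -/

section Duhamel

variable {κ E : Type*} [Fintype κ] [NormedAddCommGroup E]

/-- The variation of constants formula, for the solution family `S`, the initial value `x`, and the
forcing term `∑ i, v i • g i`. -/
def duhamel [NormedSpace ℂ E] (S : ℝ → E →L[ℂ] E) (x : E) (v : κ → ℝ → ℂ) (g : κ → E) (t : ℝ) : E :=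
  S t x + ∑ i, ∫ s in (0 : ℝ)..t, v i (t - s) • S s (g i)

section Norm

variable [NormedSpace ℂ E]

theorem continuous_duhamel {S : ℝ → E →L[ℂ] E} (hS : ∀ x, Continuous fun t => S t x) (x : E)
    {v : κ → ℝ → ℂ} (hv : ∀ i, Continuous (v i)) (g : κ → E) : Continuous (duhamel S x v g) :=
  (hS x).add (continuous_finsetSum _ fun i _ => continuous_integral_conv (hv i) (hS (g i)))

theorem norm_integral_conv_le {f : ℝ → ℂ} {u : ℝ → E} {V K r t : ℝ} (ht : 0 ≤ t)
    (hf : ∀ s, 0 ≤ s → ‖f s‖ ≤ V * Real.exp ((r - 1) * s))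
    (hu : ∀ s, 0 ≤ s → ‖u s‖ ≤ K * Real.exp (r * s)) :
    ‖∫ s in (0 : ℝ)..t, f (t - s) • u s‖ ≤ V * K * Real.exp (r * t) := by
  have hV : 0 ≤ V := by simpa using (norm_nonneg _).trans (hf 0 le_rfl)
  have hK : 0 ≤ K := by simpa using (norm_nonneg _).trans (hu 0 le_rfl)
  have hle : ∀ s ∈ Ioc 0 t, ‖f (t - s) • u s‖
      ≤ V * K * Real.exp ((r - 1) * t) * Real.exp s := fun s hs => by
    calc ‖f (t - s) • u s‖ = ‖f (t - s)‖ * ‖u s‖ := norm_smul _ _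
      _ ≤ V * Real.exp ((r - 1) * (t - s)) * (K * Real.exp (r * s)) :=
          mul_le_mul (hf _ (sub_nonneg.2 hs.2)) (hu s hs.1.le) (norm_nonneg _) (by positivity)
      _ = V * K * (Real.exp ((r - 1) * (t - s)) * Real.exp (r * s)) := by ring
      _ = V * K * (Real.exp ((r - 1) * t) * Real.exp s) := by
          rw [← Real.exp_add, ← Real.exp_add]
          ring_nf
      _ = V * K * Real.exp ((r - 1) * t) * Real.exp s := by ring
  calc ‖∫ s in (0 : ℝ)..t, f (t - s) • u s‖
      ≤ ∫ s in (0 : ℝ)..t, V * K * Real.exp ((r - 1) * t) * Real.exp s :=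
        intervalIntegral.norm_integral_le_of_norm_le ht (Eventually.of_forall hle)
          (Continuous.intervalIntegrable (by fun_prop) _ _)
    _ = V * K * Real.exp ((r - 1) * t) * (Real.exp t - 1) := by
        rw [intervalIntegral.integral_const_mul, integral_exp, Real.exp_zero]
    _ ≤ V * K * Real.exp ((r - 1) * t) * Real.exp t := by
        gcongr
        linarith
    _ = V * K * Real.exp (r * t) := by
        rw [mul_assoc, ← Real.exp_add]
        ring_nf

theorem norm_duhamel_le {S : ℝ → E →L[ℂ] E} {x : E} {v : κ → ℝ → ℂ} {g : κ → E} {K r V t : ℝ}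
    (hS : ∀ s, 0 ≤ s → ∀ x, ‖S s x‖ ≤ K * Real.exp (r * s) * ‖x‖)
    (hv : ∀ i s, 0 ≤ s → ‖v i s‖ ≤ V * Real.exp ((r - 1) * s)) (ht : 0 ≤ t) :
    ‖duhamel S x v g t‖ ≤ K * (‖x‖ + V * ∑ i, ‖g i‖) * Real.exp (r * t) :=
  calc ‖duhamel S x v g t‖ ≤ ‖S t x‖ + ∑ i, ‖∫ s in (0 : ℝ)..t, v i (t - s) • S s (g i)‖ :=
        (norm_add_le _ _).trans (add_le_add_right (norm_sum_le _ _) _)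
    _ ≤ K * Real.exp (r * t) * ‖x‖ + ∑ i, V * (K * ‖g i‖) * Real.exp (r * t) :=
        add_le_add (hS t ht x) (Finset.sum_le_sum fun i _ => norm_integral_conv_le ht (hv i)
          fun s hs => (hS s hs (g i)).trans_eq (mul_right_comm _ _ _))
    _ = K * (‖x‖ + V * ∑ i, ‖g i‖) * Real.exp (r * t) := by
        rw [← Finset.sum_mul, ← Finset.mul_sum, ← Finset.mul_sum]
        ring

end Norm

section Diagonal

variable {ι : Type*} [InnerProductSpace ℂ E] [CompleteSpace E] {b : HilbertBasis ι ℂ E}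
  {lam : ι → ℝ} {δ : ℝ} {S P : ℝ → E →L[ℂ] E} {v : κ → ℝ → ℂ}

theorem IsDiagonalFamily.inner_duhamel {m : ι → ℝ → ℝ} (hS : IsDiagonalFamily b m S)
    (hm : ∀ n, Continuous (m n)) (x : E) (hv : ∀ i, Continuous (v i)) (g : κ → E) {t : ℝ}
    (ht : 0 ≤ t) (n : ι) :
    inner ℂ (b n) (duhamel S x v g t)
      = response (m n) (inner ℂ (b n) x) (fun s => inner ℂ (b n) (∑ i, v i s • g i)) t := by
  have hmn := hm n
  have hterm : ∀ i, inner ℂ (b n) (∫ s in (0 : ℝ)..t, v i (t - s) • S s (g i))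
      = ∫ s in (0 : ℝ)..t, (m n (t - s) : ℂ) * (v i s * inner ℂ (b n) (g i)) := fun i => by
    have hsub := intervalIntegral.integral_comp_sub_left (a := 0) (b := t)
      (fun s => (m n (t - s) : ℂ) * (v i s * inner ℂ (b n) (g i))) t
    rw [sub_zero, sub_self] at hsub
    rw [inner_integral_conv _ (hv i) (hS.continuous_apply (g i)), ← hsub]
    refine intervalIntegral.integral_congr fun s hs => ?_
    rw [uIcc_of_le ht] at hs
    simp only [hS.inner_apply s hs.1, sub_sub_cancel, RCLike.ofReal_eq_complex_ofReal]
    ring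
  rw [duhamel, response, inner_add_right, hS.inner_apply t ht, inner_sum,
    Finset.sum_congr rfl fun i _ => hterm i, ← intervalIntegral.integral_finsetSum fun i _ =>
      Continuous.intervalIntegrable (by fun_prop) _ _]
  simp only [inner_sum, inner_smul_right, Finset.mul_sum, RCLike.ofReal_eq_complex_ofReal]

theorem isModalSolution_duhamel (hS : IsDiagonalFamily b (fun n => modeY δ (lam n)) S)
    (hP : IsDiagonalFamily b (fun n => modeP δ (lam n)) P) (y₀ : E) (hv : ∀ i, Continuous (v i))
    (g : κ → E) :
    IsModalSolution b lam δ (fun t => ∑ i, v i t • g i) y₀ (duhamel S y₀ v g)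
      (duhamel P y₀ v g) where
  continuous_forcing := continuous_finsetSum _ fun i _ => (hv i).smul continuous_const
  continuous := continuous_duhamel hS.continuous_apply y₀ hv g
  continuous_p := continuous_duhamel hP.continuous_apply y₀ hv g
  inner_eq _ ht n := hS.inner_duhamel (fun _ => continuous_modeY _ _) y₀ hv g ht n
  inner_p_eq _ ht n := hP.inner_duhamel (fun _ => continuous_modeP _ _) y₀ hv g ht n

theorem apply_eq_sub_integral (hS : IsDiagonalFamily b (fun n => modeY δ (lam n)) S)
    (hP : IsDiagonalFamily b (fun n => modeP δ (lam n)) P) {A : E →ₗ.[ℂ] E}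
    (hA : IsDiagonalizedBy A b lam) {x w : E} (hxw : (x, w) ∈ A.graph) {t : ℝ} (ht : 0 ≤ t) :
    S t x = x - ∫ s in (0 : ℝ)..t, P s w := by
  refine hilbertBasis_ext b fun n => ?_
  have hmode := intervalIntegral.integral_eq_sub_of_hasDerivAt (a := 0) (b := t)
    (fun s _ => hasDerivAt_modeY δ (lam n) s) (Continuous.intervalIntegrable (by fun_prop) _ _)
  have hint : ∫ s in (0 : ℝ)..t, inner ℂ (b n) (P s w)
      = -inner ℂ (b n) x * ((∫ s in (0 : ℝ)..t, -lam n * modeP δ (lam n) s : ℝ) : ℂ) := by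
    rw [← intervalIntegral.integral_ofReal, ← intervalIntegral.integral_const_mul]
    refine intervalIntegral.integral_congr fun s hs => ?_
    rw [uIcc_of_le ht] at hs
    simp only [hP.inner_apply s hs.1, (hA _ _).1 hxw n, RCLike.ofReal_eq_complex_ofReal,
      Complex.ofReal_mul, Complex.ofReal_neg]
    ring
  rw [hS.inner_apply t ht, inner_sub_right, inner_intervalIntegral _ (hP.continuous_apply w), hint,
    hmode, modeY_zero, RCLike.ofReal_eq_complex_ofReal, Complex.ofReal_sub, Complex.ofReal_one]
  ring

theorem hasDerivWithinAt_duhamel (hS : IsDiagonalFamily b (fun n => modeY δ (lam n)) S)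
    (hP : IsDiagonalFamily b (fun n => modeP δ (lam n)) P) {A : E →ₗ.[ℂ] E}
    (hA : IsDiagonalizedBy A b lam) {x w : E} (hxw : (x, w) ∈ A.graph)
    (hv : ∀ i, ContDiff ℝ 1 (v i)) (g : κ → E) {t : ℝ} (ht : 0 ≤ t) :
    HasDerivWithinAt (duhamel S x v g)
      (-P t w + ∑ i, (v i 0 • S t (g i)
        + ∫ s in (0 : ℝ)..t, deriv (v i) (t - s) • S s (g i))) (Ici 0) t := by
  have hinit : HasDerivAt (fun t => x - ∫ s in (0 : ℝ)..t, P s w) (-P t w) t :=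
    ((hP.continuous_apply w).integral_hasStrictDerivAt 0 t).hasDerivAt.const_sub x
  have hforc : HasDerivAt (fun t => ∑ i, ∫ s in (0 : ℝ)..t, v i (t - s) • S s (g i))
      (∑ i, (v i 0 • S t (g i) + ∫ s in (0 : ℝ)..t, deriv (v i) (t - s) • S s (g i))) t :=
    HasDerivAt.fun_sum fun i _ => hasDerivAt_integral_conv
      (fun s => ((hv i).differentiable one_ne_zero s).hasDerivAt) ((hv i).continuous_deriv le_rfl)
      (hS.continuous_apply (g i)) t
  refine (hinit.add hforc).hasDerivWithinAt.congr (fun s hs => ?_) ?_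
  · rw [duhamel, apply_eq_sub_integral hS hP hA hxw hs, Pi.add_apply]
  · rw [duhamel, apply_eq_sub_integral hS hP hA hxw ht, Pi.add_apply]

end Diagonal

end Duhamel

theorem isClassicalSolution_duhamel {κ ι H : Type*} [Fintype κ] [NormedAddCommGroup H]
    [InnerProductSpace ℝ H] [CompleteSpace H] {A : H →ₗ.[ℝ] H}
    {b : HilbertBasis ι ℂ (Complexification H)} {lam : ι → ℝ} {δ : ℝ}
    {S P : ℝ → Complexification H →L[ℂ] Complexification H} {y₀ : Complexification H}
    {v : κ → ℝ → ℂ} (hA : IsDiagonalizedBy (mapPMap A) b lam)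
    (hS : IsDiagonalFamily b (fun n => modeY δ (lam n)) S)
    (hP : IsDiagonalFamily b (fun n => modeP δ (lam n)) P) (hy₀ : y₀ ∈ (mapPMap A).domain)
    (hv : ∀ i, ContDiff ℝ 1 (v i)) (g : κ → Complexification H) :
    IsClassicalSolution A δ (fun t => ∑ i, v i t • g i) y₀ (duhamel S y₀ v g) := by
  have hvc : ∀ i, Continuous (v i) := fun i => (hv i).continuous
  refine (isModalSolution_duhamel hS hP y₀ hvc g).isClassicalSolution hA ?_ fun t ht =>
    hasDerivWithinAt_duhamel hS hP hA ((mapPMap A).mem_graph ⟨y₀, hy₀⟩) hv g ht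
  exact (hP.continuous_apply _).neg.add (continuous_finsetSum _ fun i _ =>
    ((hS.continuous_apply (g i)).const_smul (v i 0)).add
      (continuous_integral_conv ((hv i).continuous_deriv le_rfl) (hS.continuous_apply (g i))))

/-! ### Stabilization -/

section Steering

variable {ι κ E : Type*} [Fintype κ] [NormedAddCommGroup E] [InnerProductSpace ℂ E]
  {lam : ι → ℝ} {δ γ r T : ℝ} {S S' : ℝ → E →L[ℂ] E} {x : E} {v : κ → ℝ → ℂ} {g : κ → E}

theorem exists_isDiagonalFamily_modeY (b : HilbertBasis ι ℂ E) (hδ : -1 < δ)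
    (hl : ∀ n, 1 - lam n ≤ r) (hr : -(1 + δ) ≤ r) :
    ∃ S, IsDiagonalFamily b (fun n => modeY δ (lam n)) S ∧
      ∀ t, 0 ≤ t → ∀ x, ‖S t x‖ ≤ √((2 + δ) / (1 + δ)) * Real.exp (r * t) * ‖x‖ :=
  exists_isDiagonalFamily b (fun n => continuous_modeY δ (lam n)) (by fun_prop)
    (fun t _ => by positivity) fun n _ ht => abs_modeY_le hδ (hl n) hr ht

theorem exists_isDiagonalFamily_modeP (b : HilbertBasis ι ℂ E) (hδ : -1 ≤ δ)
    (hl : ∀ n, 1 - lam n ≤ r) (hr : -(1 + δ) ≤ r) :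
    ∃ P, IsDiagonalFamily b (fun n => modeP δ (lam n)) P :=
  (exists_isDiagonalFamily b (fun n => continuous_modeP δ (lam n))
    (r := fun t => Real.exp (r * t)) (by fun_prop) (fun t _ => (Real.exp_pos _).le)
    fun n _ ht => abs_modeP_le hδ (hl n) hr ht).imp fun _ => And.left

/-- The multipliers `modeY δ (lam n)`, those of the unstable modes replaced by `0`. -/
def stableMode (lam : ℕ → ℝ) (δ γ : ℝ) (n : ℕ) : ℝ → ℝ :=
  if unstableDim lam δ γ ≤ n then modeY δ (lam n) else 0

theorem continuous_stableMode (lam : ℕ → ℝ) (δ γ : ℝ) (n : ℕ) :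
    Continuous (stableMode lam δ γ n) := by
  rw [stableMode]
  split_ifs
  exacts [continuous_modeY δ (lam n), continuous_zero]

theorem exists_isDiagonalFamily_stableMode (b : HilbertBasis ℕ ℂ E) {lam : ℕ → ℝ} (hδ : -1 < δ)
    (hlam : Tendsto lam atTop atTop) (hγ : γ < δ + 1) :
    ∃ K S, IsDiagonalFamily b (stableMode lam δ γ) S ∧
      ∀ t, 0 ≤ t → ∀ x, ‖S t x‖ ≤ K * Real.exp (-γ * t) * ‖x‖ := by
  obtain ⟨K, hK⟩ := exists_forall_abs_modeY_le hδ hlam hγ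
  refine ⟨|K|, exists_isDiagonalFamily b (continuous_stableMode lam δ γ) (by fun_prop)
    (fun t _ => by positivity) fun n t ht => ?_⟩
  rw [stableMode]
  split_ifs with hn
  · rw [neg_mul]
    exact (hK n hn t ht).trans (mul_le_mul_of_nonneg_right (le_abs_self K) (Real.exp_pos _).le)
  · rw [Pi.zero_apply, abs_zero]
    positivity

variable [CompleteSpace E]

theorem duhamel_eq_of_moments {b : HilbertBasis ℕ ℂ E} {lam : ℕ → ℝ}
    (hS : IsDiagonalFamily b (fun n => modeY δ (lam n)) S)
    (hS' : IsDiagonalFamily b (stableMode lam δ γ) S') (hv : ∀ i, Continuous (v i))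
    (hvT : ∀ i t, T ≤ t → v i t = 0)
    (hmom : ∀ n < unstableDim lam δ γ,
      (∫ s in (0 : ℝ)..T, (modeP δ (lam n) (-s) : ℂ) * inner ℂ (b n) (∑ i, v i s • g i)
        = -inner ℂ (b n) x) ∧
      ∫ s in (0 : ℝ)..T, (modeZ δ (lam n) (-s) : ℂ) * inner ℂ (b n) (∑ i, v i s • g i) = 0)
    {t : ℝ} (ht : 0 ≤ t) (hTt : T ≤ t) : duhamel S x v g t = duhamel S' x v g t := by
  refine hilbertBasis_ext b fun n => ?_
  rw [hS.inner_duhamel (fun n => continuous_modeY δ (lam n)) x hv g ht,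
    hS'.inner_duhamel (continuous_stableMode lam δ γ) x hv g ht, stableMode]
  split_ifs with hn
  · rfl
  · obtain ⟨hP, hZ⟩ := hmom n (not_le.1 hn)
    rw [response_modeY_eq_zero δ (lam n) (inner ℂ (b n) x) (by fun_prop) (fun s hs => by
      simp only [hvT _ s hs, zero_smul, Finset.sum_const_zero, inner_zero_right]) hP hZ hTt]
    simp [response]

end Steering

section TwoPhases

variable {κ E : Type*} [Fintype κ] [NormedAddCommGroup E] [NormedSpace ℂ E]
  {γ r K K' V T : ℝ} {S S' : ℝ → E →L[ℂ] E} {x : E} {v : κ → ℝ → ℂ} {g : κ → E}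

theorem exp_mul_le_of_le {t : ℝ} (hr : -γ ≤ r) (ht : t ≤ T) :
    Real.exp (r * t) ≤ Real.exp ((r + γ) * T) * Real.exp (-γ * t) := by
  rw [← Real.exp_add, Real.exp_le_exp]
  linarith [mul_le_mul_of_nonneg_left ht (neg_le_iff_add_nonneg.1 hr)]

theorem norm_duhamel_le_of_eq_of_ge
    (hS : ∀ t, 0 ≤ t → ∀ x, ‖S t x‖ ≤ K * Real.exp (r * t) * ‖x‖)
    (hS' : ∀ t, 0 ≤ t → ∀ x, ‖S' t x‖ ≤ K' * Real.exp (-γ * t) * ‖x‖) (hr : -γ ≤ r)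
    (hv : ∀ i t, 0 ≤ t → ‖v i t‖ ≤ V * ‖x‖ * Real.exp ((-γ - 1) * t)) (hV : 0 ≤ V)
    (heq : ∀ t, 0 ≤ t → T ≤ t → duhamel S x v g t = duhamel S' x v g t) {t : ℝ} (ht : 0 ≤ t) :
    ‖duhamel S x v g t‖ ≤ max (K * Real.exp ((r + γ) * T)) K' * (1 + V * ∑ i, ‖g i‖)
      * Real.exp (-(γ * t)) * ‖x‖ := by
  have hfactor : ∀ a c, a * (‖x‖ + V * ‖x‖ * ∑ i, ‖g i‖) * c
      = a * (1 + V * ∑ i, ‖g i‖) * c * ‖x‖ := fun a c => by ring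
  rw [← hfactor, ← neg_mul]
  rcases le_total t T with htT | htT
  · have hbound := norm_duhamel_le (g := g) (x := x) hS (fun i s hs => (hv i s hs).trans
      (mul_le_mul_of_nonneg_left (Real.exp_le_exp.2 (mul_le_mul_of_nonneg_right
        (sub_le_sub_right hr 1) hs)) (by positivity))) ht
    have hcoef : 0 ≤ K * (‖x‖ + V * ‖x‖ * ∑ i, ‖g i‖) :=
      nonneg_of_mul_nonneg_left ((norm_nonneg _).trans hbound) (Real.exp_pos _)
    calc ‖duhamel S x v g t‖
        ≤ K * (‖x‖ + V * ‖x‖ * ∑ i, ‖g i‖) * Real.exp (r * t) := hbound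
      _ ≤ K * (‖x‖ + V * ‖x‖ * ∑ i, ‖g i‖) * (Real.exp ((r + γ) * T) * Real.exp (-γ * t)) :=
          mul_le_mul_of_nonneg_left (exp_mul_le_of_le hr htT) hcoef
      _ = K * Real.exp ((r + γ) * T) * (‖x‖ + V * ‖x‖ * ∑ i, ‖g i‖) * Real.exp (-γ * t) := by ring
      _ ≤ _ := by
          gcongr
          exact le_max_left _ _
  · rw [heq t ht htT]
    refine (norm_duhamel_le hS' hv ht).trans ?_
    gcongr
    exact le_max_right _ _

end TwoPhases

section Synthesis

variable {H : Type*} [NormedAddCommGroup H] [InnerProductSpace ℝ H]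
  {A : H →ₗ.[ℝ] H} {B : H →L[ℝ] H} {δ γ C T : ℝ} {M : ℕ} {Φ : Fin M → Complexification H}

theorem mapL_control (v : Fin M → ℝ → ℂ) (t : ℝ) :
    mapL B (control Φ v t) = ∑ i, v i t • mapL B (Φ i) := by
  simp only [control, map_sum, map_smul]

theorem Stabilizes.mono {C' : ℝ} {u : ℝ → Complexification H} {y₀ : Complexification H}
    (h : Stabilizes A B δ γ C u y₀) (hC : C ≤ C') : Stabilizes A B δ γ C' u y₀ :=
  let ⟨y, hy, huniq, hclass, hbound⟩ := h
  ⟨y, hy, huniq, hclass, fun t ht => (hbound t ht).trans (by gcongr)⟩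

theorem norm_inner_orthonormal_le {𝕜 E ι : Type*} [RCLike 𝕜] [NormedAddCommGroup E]
    [InnerProductSpace 𝕜 E] [Fintype ι] {e : ι → E} (he : Orthonormal 𝕜 e) (x : E) :
    ‖fun n => inner 𝕜 (e n) x‖ ≤ ‖x‖ :=
  (pi_norm_le_iff_of_nonneg (norm_nonneg x)).2 fun n =>
    (norm_inner_le_norm _ _).trans_eq (by rw [he.1, one_mul])

variable [CompleteSpace H]

theorem stabilizes_of_norm_duhamel_le {ι : Type*} {b : HilbertBasis ι ℂ (Complexification H)}
    {lam : ι → ℝ} (hA : IsDiagonalizedBy (mapPMap A) b lam)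
    {S P : ℝ → Complexification H →L[ℂ] Complexification H}
    (hS : IsDiagonalFamily b (fun n => modeY δ (lam n)) S)
    (hP : IsDiagonalFamily b (fun n => modeP δ (lam n)) P) {v : Fin M → ℝ → ℂ}
    (hv : ∀ i, ContDiff ℝ 1 (v i)) {y₀ : Complexification H}
    (hC : ∀ t, 0 ≤ t → ‖duhamel S y₀ v (fun i => mapL B (Φ i)) t‖
      ≤ C * Real.exp (-(γ * t)) * ‖y₀‖) :
    Stabilizes A B δ γ C (control Φ v) y₀ := by
  have hweak := (isModalSolution_duhamel hS hP y₀ (fun i => (hv i).continuous)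
    fun i => mapL B (Φ i)).isWeakSolution hA
  simp only [Stabilizes, mapL_control]
  exact ⟨_, hweak, fun z hz => hweak.eqOn hA hz,
    fun hy₀ => isClassicalSolution_duhamel hA hS hP hy₀ hv _, hC⟩

theorem exists_stabilizing_nullControl {φ : HilbertBasis ℕ ℝ H} {lam : ℕ → ℝ}
    (hA : IsDiagonalizedBy A φ lam) (hlam : Tendsto lam atTop atTop) (hδ : -1 < δ)
    (hγ : γ < δ + 1) (hT : 0 < T)
    (hC : HautusCondition (fun n : Fin (unstableDim lam δ γ) => lam n)
      (controlMatrix B (fun n : Fin (unstableDim lam δ γ) => φ n) Φ)) :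
    ∃ (R : (Fin (unstableDim lam δ γ) → ℂ) →ₗ[ℂ] vanishingControls (Fin M) T) (C : ℝ), ∀ y₀,
      Stabilizes A B δ γ C (control Φ (R fun n => inner ℂ (ofReal (φ n)) y₀).1) y₀ := by
  obtain ⟨R, hR⟩ := hC.exists_nullControl (δ := δ) (by linarith) hT
  obtain ⟨V, hV⟩ := exists_forall_norm_derivs_le R
    (g := fun t => Real.exp ((-γ - 1) * t)) (by fun_prop) fun t => Real.exp_pos _
  set b := Complexification.hilbertBasis φ
  obtain ⟨l, hl⟩ := bddBelow_range_of_tendsto_atTop_atTop hlam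
  set r := max (1 - l) (max (-(1 + δ)) (-γ))
  have hlr : ∀ n, 1 - lam n ≤ r := fun n =>
    (sub_le_sub_left (hl ⟨n, rfl⟩) 1).trans (le_max_left _ _)
  have hδr : -(1 + δ) ≤ r := (le_max_left _ _).trans (le_max_right _ _)
  obtain ⟨S, hS, hSr⟩ := exists_isDiagonalFamily_modeY b hδ hlr hδr
  obtain ⟨P, hP⟩ := exists_isDiagonalFamily_modeP b hδ.le hlr hδr
  obtain ⟨K, S', hS', hSγ⟩ := exists_isDiagonalFamily_stableMode b hδ hlam hγ
  refine ⟨R, _, fun y₀ => stabilizes_of_norm_duhamel_le hA.mapPMap hS hP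
    (fun i => (((R _).2 i).1.of_le one_le_two)) fun t ht => norm_duhamel_le_of_eq_of_ge hSr hSγ
      ((le_max_right _ _).trans (le_max_right _ _)) (fun i t ht => ?_) (abs_nonneg V)
      (fun t ht hTt => duhamel_eq_of_moments hS hS' (continuous_coe_vanishingControls _)
        (fun i => ((R _).2 i).2) (fun n hn => ?_) ht hTt) ht⟩
  · have hy₀ := norm_inner_orthonormal_le ((orthonormal_ofReal φ.orthonormal).comp
      (Fin.val : Fin (unstableDim lam δ γ) → ℕ) Fin.val_injective) y₀
    calc ‖(R _).1 i t‖
        ≤ V * Real.exp ((-γ - 1) * t) * ‖fun n : Fin (unstableDim lam δ γ) =>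
            inner ℂ (ofReal (φ n)) y₀‖ :=
          ((le_add_of_nonneg_right (norm_nonneg _)).trans
            (le_add_of_nonneg_right (norm_nonneg _))).trans (hV _ i t ht)
      _ ≤ |V| * Real.exp ((-γ - 1) * t) * ‖y₀‖ := by
          gcongr
          exacts [le_abs_self V, hy₀]
      _ = |V| * ‖y₀‖ * Real.exp ((-γ - 1) * t) := by ring
  · have hrow : ∀ s, inner ℂ (b n) (∑ i, (R fun n => inner ℂ (ofReal (φ n)) y₀).1 i s •
        mapL B (Φ i)) = ∑ i, controlMatrix B (fun n : Fin (unstableDim lam δ γ) => φ n) Φ ⟨n, hn⟩ i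
          * (R fun n => inner ℂ (ofReal (φ n)) y₀).1 i s := fun s => by
      simp only [b, Complexification.hilbertBasis_apply, inner_sum, inner_smul_right, mul_comm,
        controlMatrix, Matrix.of_apply]
    simp only [hrow]
    simpa only [b, Complexification.hilbertBasis_apply] using
      hR (fun n => inner ℂ (ofReal (φ n)) y₀) ⟨n, hn⟩

end Synthesis

/-! ### The control as a memory integral -/

section MemoryInput

variable {δ T : ℝ}

/-- The input `w` for which `v t = -∫ s in t..T, kernel δ (t - s) * w s`, when `v` vanishes at
`T`. -/
def memoryInput (δ : ℝ) (v : ℝ → ℂ) (t : ℝ) : ℂ := deriv v t + δ * v t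

theorem continuous_memoryInput {v : ℝ → ℂ} (hv : ContDiff ℝ 1 v) : Continuous (memoryInput δ v) :=
  (hv.continuous_deriv le_rfl).add (continuous_const.mul hv.continuous)

theorem eq_neg_integral_kernel_memoryInput {v : ℝ → ℂ} (hv : ContDiff ℝ 1 v) (hvT : v T = 0)
    (t : ℝ) : v t = -∫ s in t..T, (kernel δ (t - s) : ℂ) * memoryInput δ v s := by
  simp only [memoryInput]
  rw [integral_kernel_mul_deriv_add δ
    (fun s => (hv.differentiable one_ne_zero s).hasDerivAt) (hv.continuous_deriv le_rfl), hvT]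
  simp

theorem memoryInput_eq_zero {v : ℝ → ℂ} (hv : ContDiff ℝ 1 v) (hvT : ∀ t, T ≤ t → v t = 0) {t : ℝ}
    (ht : T ≤ t) : memoryInput δ v t = 0 := by
  have hderiv := iteratedDeriv_eq_zero_of_forall_ge (n := 1) hv hvT ht
  rw [iteratedDeriv_one] at hderiv
  rw [memoryInput, hderiv, hvT t ht, mul_zero, add_zero]

theorem memLp_restrict_Ioc_of_continuous {E : Type*} [NormedAddCommGroup E] {f : ℝ → E}
    (hf : Continuous f) (p : ENNReal) (a b : ℝ) : MemLp f p (volume.restrict (Ioc a b)) := by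
  obtain ⟨K, hK⟩ := isCompact_Icc.exists_bound_of_continuousOn (s := Icc a b) hf.continuousOn
  refine MemLp.of_bound hf.aestronglyMeasurable K ?_
  filter_upwards [ae_restrict_mem measurableSet_Ioc] with t ht using hK t (Ioc_subset_Icc_self ht)

theorem integral_norm_sq_le {E : Type*} [NormedAddCommGroup E] {f : ℝ → E} (hf : Continuous f)
    {a b K : ℝ} (hab : a ≤ b) (hK : ∀ t ∈ Icc a b, ‖f t‖ ≤ K) :
    ∫ t in a..b, ‖f t‖ ^ 2 ≤ (b - a) * K ^ 2 := by
  calc ∫ t in a..b, ‖f t‖ ^ 2 ≤ ∫ _ in a..b, K ^ 2 :=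
        intervalIntegral.integral_mono_on hab ((hf.norm.pow 2).intervalIntegrable _ _)
          intervalIntegrable_const fun t ht => pow_le_pow_left₀ (norm_nonneg _) (hK t ht) 2
    _ = (b - a) * K ^ 2 := by rw [intervalIntegral.integral_const, smul_eq_mul]

theorem exists_forall_integral_sq_memoryInput_le {ι κ : Type*} [Fintype ι] [Finite κ] (δ : ℝ)
    (hT : 0 ≤ T) (R : (ι → ℂ) →ₗ[ℂ] vanishingControls κ T) :
    ∃ K, ∀ c i, ∫ t in (0 : ℝ)..T, ‖memoryInput δ ((R c).1 i) t‖ ^ 2 ≤ K * ‖c‖ ^ 2 := by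
  obtain ⟨K, hK⟩ := exists_forall_norm_derivs_le R continuous_one fun _ => one_pos
  refine ⟨T * ((1 + |δ|) * K) ^ 2, fun c i => ?_⟩
  have hbound : ∀ t ∈ Icc 0 T, ‖memoryInput δ ((R c).1 i) t‖ ≤ (1 + |δ|) * K * ‖c‖ := by
    intro t ht
    have hderivs := hK c i t ht.1
    rw [Pi.one_apply, mul_one] at hderivs
    have hv := norm_nonneg ((R c).1 i t)
    have hv' := norm_nonneg (deriv ((R c).1 i) t)
    have hv'' := norm_nonneg (deriv (deriv ((R c).1 i)) t)
    calc ‖memoryInput δ ((R c).1 i) t‖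
        ≤ ‖deriv ((R c).1 i) t‖ + |δ| * ‖(R c).1 i t‖ := by
          refine (norm_add_le _ _).trans_eq ?_
          rw [norm_mul, Complex.norm_real, Real.norm_eq_abs]
      _ ≤ K * ‖c‖ + |δ| * (K * ‖c‖) := by
          gcongr <;> linarith
      _ = (1 + |δ|) * K * ‖c‖ := by ring
  refine (integral_norm_sq_le (continuous_memoryInput (((R c).2 i).1.of_le one_le_two)) hT
    hbound).trans_eq ?_
  rw [sub_zero, mul_pow _ ‖c‖, mul_assoc]

end MemoryInput

section Directions

variable {H : Type*} [NormedAddCommGroup H] [InnerProductSpace ℝ H]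
  {A : H →ₗ.[ℝ] H} {e : ℕ → H} {N M : ℕ} {Φ : Fin M → Complexification H}

theorem mem_domain_mapPMap_of_eq_ofReal_or_mem_span (he : ∀ n, e n ∈ A.domain)
    (hΦ : (∀ i : Fin M, Φ i = ofReal (e i)) ∨
      ∀ i, Φ i ∈ Submodule.span ℂ (range fun k : Fin N => ofReal (e k))) (i : Fin M) :
    Φ i ∈ (mapPMap A).domain := by
  rcases hΦ with hΦ | hΦ
  · exact hΦ i ▸ ofReal_mem_domain_mapPMap (he i)
  · exact Submodule.span_le.2 (range_subset_iff.2 fun k : Fin N =>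
      ofReal_mem_domain_mapPMap (he k)) (hΦ i)

end Directions

end PIDE

end

theorem mainTheorem3_general {H : Type*} [NormedAddCommGroup H] [InnerProductSpace ℝ H]
    [CompleteSpace H] (A : H →ₗ.[ℝ] H) (hA : IsSelfAdjoint A) (B : H →L[ℝ] H)
    (φ : HilbertBasis ℕ ℝ H) (lam : ℕ → ℝ) (hlam : Filter.Tendsto lam Filter.atTop Filter.atTop)
    (hφ : ∀ n, ∃ h : φ n ∈ A.domain, A ⟨φ n, h⟩ = lam n • φ n)
    (δ γ : ℝ) (hδ : -1 < δ) (hγδ : γ < δ + 1) (M : ℕ) (Φ : Fin M → Complexification H)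
    (hΦ : PIDE.HautusCondition (fun n : Fin (PIDE.unstableDim lam δ γ) => lam n)
      (PIDE.controlMatrix B (fun n : Fin (PIDE.unstableDim lam δ γ) => φ n) Φ)) :
    (∀ T : ℝ, 0 < T → ∃ C : ℝ, ∀ y₀ : Complexification H,
      ∃ v w : Fin M → ℝ → ℂ,
        (∀ i, ContinuousOn (v i) (Set.Ici 0)) ∧
        (∀ i, MeasureTheory.MemLp (w i) 2
          (MeasureTheory.volume.restrict (Set.Ioc 0 T))) ∧
        (∀ i, ∀ t ∈ Set.Icc 0 T,
          v i t = -∫ s in t..T, (PIDE.kernel δ (t - s) : ℂ) * w i s) ∧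
        (∀ i, (∫ t in (0 : ℝ)..T, ‖w i t‖ ^ 2) ≤ C * ‖y₀‖ ^ 2) ∧
        (∀ i, ∀ t, T ≤ t → v i t = 0 ∧ w i t = 0) ∧
        PIDE.Stabilizes A B δ γ C (PIDE.control Φ v) y₀) ∧
    (∃ C : ℝ, ∀ y₀ : Complexification H,
      ∃ v : Fin M → ℝ → ℂ,
        (∀ i, ContDiffOn ℝ 2 (v i) (Set.Ici 0)) ∧
        (∀ i, ∀ t, 0 < t →
          ‖v i t‖ + ‖deriv (v i) t‖ + ‖deriv (deriv (v i)) t‖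
            ≤ C * Real.exp (-(γ * t)) * ‖y₀‖) ∧
        PIDE.Stabilizes A B δ γ C (PIDE.control Φ v) y₀) := by
  have hdiag : PIDE.IsDiagonalizedBy A φ lam := PIDE.isDiagonalizedBy_of_isSelfAdjoint hA fun n =>
    let ⟨h, hn⟩ := hφ n
    (LinearPMap.mem_graph_iff _).2 ⟨⟨φ n, h⟩, rfl, hn⟩
  have hdata := PIDE.norm_inner_orthonormal_le ((Complexification.orthonormal_ofReal
    φ.orthonormal).comp (Fin.val : Fin (PIDE.unstableDim lam δ γ) → ℕ) Fin.val_injective)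
  constructor
  · intro T hT
    obtain ⟨R, C, hC⟩ := PIDE.exists_stabilizing_nullControl hdiag hlam hδ hγδ hT hΦ
    obtain ⟨K, hK⟩ := PIDE.exists_forall_integral_sq_memoryInput_le δ hT.le R
    refine ⟨max C |K|, fun y₀ => ?_⟩
    let v := R fun n => inner ℂ (Complexification.ofReal (φ n)) y₀
    have hv : ∀ i, ContDiff ℝ 1 (v.1 i) := fun i => (v.2 i).1.of_le one_le_two
    refine ⟨v.1, fun i => PIDE.memoryInput δ (v.1 i), fun i => (hv i).continuous.continuousOn,
      fun i => PIDE.memLp_restrict_Ioc_of_continuous (PIDE.continuous_memoryInput (hv i)) 2 0 T,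
      fun i t _ => PIDE.eq_neg_integral_kernel_memoryInput (hv i) ((v.2 i).2 T le_rfl) t,
      fun i => (hK _ i).trans ?_,
      fun i t ht => ⟨(v.2 i).2 t ht, PIDE.memoryInput_eq_zero (hv i) (v.2 i).2 ht⟩,
      (hC y₀).mono (le_max_left _ _)⟩
    gcongr
    exacts [(le_abs_self K).trans (le_max_right _ _), hdata y₀]
  · obtain ⟨R, C, hC⟩ := PIDE.exists_stabilizing_nullControl hdiag hlam hδ hγδ one_pos hΦ
    obtain ⟨K, hK⟩ := PIDE.exists_forall_norm_derivs_le R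
      (g := fun t => Real.exp (-(γ * t))) (by fun_prop) fun t => Real.exp_pos _
    refine ⟨max C |K|, fun y₀ => ⟨_, fun i => ((R _).2 i).1.contDiffOn, fun i t ht => ?_,
      (hC y₀).mono (le_max_left _ _)⟩⟩
    refine (hK _ i t ht.le).trans ?_
    gcongr
    exacts [(le_abs_self K).trans (le_max_right _ _), hdata y₀]

theorem mainTheorem3 {H : Type*} [NormedAddCommGroup H] [InnerProductSpace ℝ H] [CompleteSpace H]
    (A : H →ₗ.[ℝ] H) (hA_dense : Dense (A.domain : Set H)) (hA_selfAdjoint : IsSelfAdjoint A)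
    (hA_pos : ∀ x : A.domain, x ≠ 0 → 0 < inner ℝ (A x) (x : H))
    (hA_resolvent : PIDE.HasCompactResolvent A)
    (B : H →L[ℝ] H)
    (φ : HilbertBasis ℕ ℝ H) (lam : ℕ → ℝ) (hlam : Monotone lam)
    (hφ : ∀ n, ∃ h : φ n ∈ A.domain, A ⟨φ n, h⟩ = lam n • φ n)
    (δ γ : ℝ) (hδ : 0 < δ) (hγ : 0 < γ) (hγδ : γ < δ + 1)
    (N M : ℕ) (hN : N = PIDE.unstableDim lam δ γ) (hM : M = PIDE.maxMultiplicity lam N)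
    (Φ : Fin M → Complexification H)
    (hΦ :
      (PIDE.SemisimpleSpectrum lam δ N ∧
        (∀ i : Fin M, Φ i = Complexification.ofReal (φ i)) ∧
        PIDE.SemisimpleRankCondition B φ lam δ N Φ) ∨
      (¬ PIDE.SemisimpleSpectrum lam δ N ∧
        (∀ i : Fin M, Φ i ∈ Submodule.span ℂ
          (Set.range fun k : Fin N => Complexification.ofReal (φ k))) ∧
        PIDE.JordanRankCondition B φ lam δ N Φ)) :
    (∀ i : Fin M, Φ i ∈ (Complexification.mapPMap A).domain) ∧
    (∀ T : ℝ, 0 < T → ∃ C : ℝ, ∀ y₀ : Complexification H,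
      ∃ v w : Fin M → ℝ → ℂ,
        (∀ i, ContinuousOn (v i) (Set.Ici 0)) ∧
        (∀ i, MeasureTheory.MemLp (w i) 2
          (MeasureTheory.volume.restrict (Set.Ioc 0 T))) ∧
        (∀ i, ∀ t ∈ Set.Icc 0 T,
          v i t = -∫ s in t..T, (PIDE.kernel δ (t - s) : ℂ) * w i s) ∧
        (∀ i, (∫ t in (0 : ℝ)..T, ‖w i t‖ ^ 2) ≤ C * ‖y₀‖ ^ 2) ∧
        (∀ i, ∀ t, T ≤ t → v i t = 0 ∧ w i t = 0) ∧
        PIDE.Stabilizes A B δ γ C (PIDE.control Φ v) y₀) ∧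
    (∃ C : ℝ, ∀ y₀ : Complexification H,
      ∃ v : Fin M → ℝ → ℂ,
        (∀ i, ContDiffOn ℝ 2 (v i) (Set.Ici 0)) ∧
        (∀ i, ∀ t, 0 < t →
          ‖v i t‖ + ‖deriv (v i) t‖ + ‖deriv (deriv (v i)) t‖
            ≤ C * Real.exp (-(γ * t)) * ‖y₀‖) ∧
        PIDE.Stabilizes A B δ γ C (PIDE.control Φ v) y₀) := by
  subst hN
  have hHautus := (hΦ.elim (·.2.2.jordanRankCondition) (·.2.2)).hautusCondition
    (by linarith : 1 + δ ≠ 0)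
  exact ⟨PIDE.mem_domain_mapPMap_of_eq_ofReal_or_mem_span (fun n => (hφ n).1)
      (hΦ.imp (·.2.1) (·.2.1)),
    mainTheorem3_general A hA_selfAdjoint B φ lam
      (hA_resolvent.tendsto_eigenvalues φ.orthonormal hφ hlam) hφ δ γ (by linarith) hγδ M Φ hHautus⟩
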